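/- **Setting.** A tree-form decision problem is a finite rooted tree whose leaves (terminal nodes, set $\mathcal Z$) are reached through decision points, where the player picks the child, and observation points, where the environment picks the child. A pure strategy (an action for every decision point) is identified with the vector $x\in\{0,1\}^{\mathcal Z}$ with $x[z]=1$ iff the strategy plays all actions on the path to $z$; $\mathcal X$ is the set of these vectors and $\operatorname{co}\mathcal X$ its convex hull. The dual $\bar{\mathcal X}$ exchanges decision and observation points. The interleaving $\mathcal X\otimes\mathcal Y$ is the decision problem with states $(s_1,s_2)$, in which the environment moves (in all components that are at an observation point) if some component is at an observation point, and otherwise the player chooses a component that is not terminal and a child to move to in it; it ends when both components are terminal. It is regarded as a tree of histories; the reduced vector $q$ of a strategy of $\mathcal X\otimes\mathcal Y$ has as its coordinate at a pair of terminal nodes the sum of the strategy's vector over all histories ending in that pair, and reduced strategies are convex combinations of such vectors for pure strategies. For decision problems $\mathcal X,\mathcal Y$, the set $\Phi^k_{\mathrm{med}}$ of $k$-mediator deviations $\mathcal Y\to\operatorname{co}\mathcal X$ consists of the maps $$\phi_q(y)[z]=\sum_{z_1,\dots,z_k}q[z,z_1,\dots,z_k]\prod_{i=1}^k y[z_i],\qquad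 q \text{ a reduced strategy of } \mathcal X\otimes\bar{\mathcal Y}^{\otimes k},$$ and $\Phi_{\mathrm{lin}}$ consists of the maps $\mathcal Y\to\operatorname{co}\mathcal X$ that are restrictions of linear maps. Consider games with $n$ players, tree-form strategy sets $\mathcal X_1,\dots,\mathcal X_n$ and multilinear utilities $u_i:\mathcal X_1\times\dots\times\mathcal X_n\to[-1,1]$ (extended multilinearly). For a class of deviations $\Phi$ and $\varepsilon\ge0$, a distribution $\pi$ on $\mathcal X_1\times\dots\times\mathcal X_n$ is an $\varepsilon$-$\Phi$-equilibrium if $\mathbb E_{x\sim\pi}u_i(\psi(x_i),x_{-i})\le\mathbb E_{x\sim\pi}u_i(x)+\varepsilon$ for all $i$ and all $\psi:\mathcal X_i\to\operatorname{co}\mathcal X_i$ in $\Phi$. A generalized profile consists of decision problems $\mathcal Y_i$, maps $\phi_i:\mathcal Y_i\to\operatorname{co}\mathcal X_i$ and a distribution $\pi'$ on $\mathcal Y_1\times\dots\times\mathcal Y_n$. It is a generalized $\varepsilon$-$\Phi$-equilibrium if every $\phi_i$ is in $\Phi$ and $\mathbb E_{y\sim\pi'}u_i(\phi'(y_i),\phi_{-i}(y_{-i}))\le\mathbb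 E_{y\sim\pi'}u_i(\phi_1(y_1),\dots,\phi_n(y_n))+\varepsilon$ for all $i$ and all $\phi':\mathcal Y_i\to\operatorname{co}\mathcal X_i$ in $\Phi$. Generalized profiles are equivalent if the joint laws of $(\phi_1(y_1),\dots,\phi_n(y_n))$, $y\sim\pi'$, agree; a distribution $\pi$ on $\mathcal X_1\times\dots\times\mathcal X_n$ is regarded as the canonical profile with $\mathcal Y_i=\mathcal X_i$ and $\phi_i$ the identity. Let $\delta$ be a consistent strategy map, that is, for every decision problem a map $\delta:\operatorname{co}\mathcal X\to\Delta(\mathcal X)$ with $\mathbb E_{x'\sim\delta(x)}x'=x$. The canonical profile induced by a generalized profile is the law of $x$ obtained by sampling $y\sim\pi'$ and then $x_i\sim\delta(\phi_i(y_i))$ independently for the players. $\Phi$ satisfies the revelation principle at accuracy $\varepsilon$ if in every game the canonical profile induced by any generalized $\varepsilon$-$\Phi$-equilibrium is an $\varepsilon$-$\Phi$-equilibrium. **Theorem.** 1. For every $k\ge1$, every game and every $\varepsilon\ge0$, each $\varepsilon$-$\Phi_{\mathrm{lin}}$-equilibrium (linear-swap equilibrium) is equivalent to a generalized $\varepsilon$-$\Phi^k_{\mathrm{med}}$-equilibrium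 (generalized $k$-mediator equilibrium). 2. Consequently, for every $k\ge2$ and every consistent strategy map $\delta$, the class $\Phi^k_{\mathrm{med}}$ does not satisfy the revelation principle, already for exact equilibria ($\varepsilon=0$). -/

import Mathlib

noncomputable section

namespace TreeForm

/-- A finite tree whose leaves (terminal nodes) carry labels in `L` and whose internal nodes are
decision points (the player picks the child) or observation points (the environment picks the
child). Distinct leaves may carry the same label: a label is the *state* in which the
interaction ends, a leaf is a *history*. -/
inductive DecisionTree (L : Type) : Type 1
  | terminal (z : L) : DecisionTree L
  | decision {A : Type} [Fintype A] [Nonempty A] (child : A → DecisionTree L) : DecisionTree L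
  | observation {A : Type} [Fintype A] [Nonempty A] (child : A → DecisionTree L) : DecisionTree L

namespace DecisionTree

variable {L M : Type}

/-- Relabelling of the terminal nodes. -/
def map (f : L → M) : DecisionTree L → DecisionTree M
  | terminal z => terminal (f z)
  | decision c => decision fun a => map f (c a)
  | observation c => observation fun a => map f (c a)

/-- The dual: decision points and observation points are swapped. -/
def dual : DecisionTree L → DecisionTree L
  | terminal z => terminal z
  | decision c => observation fun a => dual (c a)
  | observation c => decision fun a => dual (c a)

/-- The number of terminal nodes with label `z`. -/
def leafCount [DecidableEq L] (z : L) : DecisionTree L → ℕ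
  | terminal w => if w = z then 1 else 0
  | decision c => ∑ a, leafCount z (c a)
  | observation c => ∑ a, leafCount z (c a)

/-- A pure strategy: one action for each decision point of the tree. -/
def PureStrategy : DecisionTree L → Type
  | terminal _ => Unit
  | @decision _ A _ _ c => A × ((a : A) → PureStrategy (c a))
  | @observation _ A _ _ c => (a : A) → PureStrategy (c a)

/-- The vector of a pure strategy: the coordinate at `z` is the number of terminal nodes with
label `z` all of whose actions on the path from the root are played by the strategy. If every
label is used by one terminal node, this is the `0/1` tree-form representation; in general it is
the sum, over all histories that end in state `z`, of the tree-form representation. -/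
def vector [DecidableEq L] : (t : DecisionTree L) → t.PureStrategy → L → ℝ
  | terminal z, _ => Pi.single z 1
  | decision c, σ => vector (c σ.1) (σ.2 σ.1)
  | observation c, σ => ∑ a, vector (c a) (σ a)

/-- The vectors of the pure strategies (identified if the vectors agree). -/
def pureVectors [DecidableEq L] (t : DecisionTree L) : Set (L → ℝ) :=
  Set.range t.vector

/-- The convex hull of the vectors of the pure strategies. -/
def mixedVectors [DecidableEq L] (t : DecisionTree L) : Set (L → ℝ) :=
  convexHull ℝ t.pureVectors

instance instFinitePureStrategy (t : DecisionTree L) : Finite t.PureStrategy := by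
  induction t with
  | terminal z => exact inferInstanceAs (Finite Unit)
  | @decision A _ _ c ih =>
      exact inferInstanceAs (Finite (A × ((a : A) → PureStrategy (c a))))
  | @observation A _ _ c ih =>
      exact inferInstanceAs (Finite ((a : A) → PureStrategy (c a)))

theorem finite_pureVectors [DecidableEq L] (t : DecisionTree L) : t.pureVectors.Finite :=
  Set.finite_range _

/-- Auxiliary to `interleave`: the interleaving of a decision point with a second tree, given
the interleavings `f a` of its children. -/
def interleaveDecision {A : Type} [Fintype A] [Nonempty A]
    (f : A → DecisionTree M → DecisionTree (L × M)) : DecisionTree M → DecisionTree (L × M)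
  | terminal w => decision fun a => f a (terminal w)
  | @decision _ B _ _ d => decision (A := A ⊕ B) <|
      Sum.elim (fun a => f a (decision d)) (fun b => interleaveDecision f (d b))
  | observation d => observation fun b => interleaveDecision f (d b)

/-- The interleaving `s ⊗ t`, as a tree of histories whose terminal nodes are labelled by the
pair of terminal states. The nine cases are spelled out in the lemmas below. -/
def interleave : DecisionTree L → DecisionTree M → DecisionTree (L × M)
  | terminal z, t => t.map fun w => (z, w)
  | decision c, t => interleaveDecision (fun a => interleave (c a)) t
  | observation c, terminal w => observation fun a => interleave (c a) (terminal w)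
  | observation c, decision d => observation fun a => interleave (c a) (decision d)
  | @observation _ A _ _ c, @observation _ B _ _ d =>
      observation (A := A × B) fun p => interleave (c p.1) (d p.2)

section InterleaveCases

variable {A B : Type} [Fintype A] [Nonempty A] [Fintype B] [Nonempty B]
  (c : A → DecisionTree L) (d : B → DecisionTree M) (z : L) (w : M)

theorem interleave_terminal_terminal :
    interleave (terminal z) (terminal w) = terminal (z, w) := rfl

theorem interleave_observation_observation :
    interleave (observation c) (observation d) =
      observation fun p : A × B => interleave (c p.1) (d p.2) := rfl

theorem interleave_observation_decision :
    interleave (observation c) (decision d) =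
      observation fun a => interleave (c a) (decision d) := rfl

theorem interleave_observation_terminal :
    interleave (observation c) (terminal w) =
      observation fun a => interleave (c a) (terminal w) := rfl

theorem interleave_decision_observation :
    interleave (decision c) (observation d) =
      observation fun b => interleave (decision c) (d b) := rfl

theorem interleave_terminal_observation :
    interleave (terminal z) (observation d) =
      observation fun b => interleave (terminal z) (d b) := rfl

theorem interleave_decision_decision :
    interleave (decision c) (decision d) =
      decision (A := A ⊕ B) (Sum.elim (fun a => interleave (c a) (decision d))
        (fun b => interleave (decision c) (d b))) := rfl

theorem interleave_decision_terminal :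
    interleave (decision c) (terminal w) =
      decision fun a => interleave (c a) (terminal w) := rfl

theorem interleave_terminal_decision :
    interleave (terminal z) (decision d) =
      decision fun b => interleave (terminal z) (d b) := rfl

end InterleaveCases

/-- The interleaving `t 0 ⊗ (t 1 ⊗ (⋯ ⊗ t (k - 1)))` of a finite family, with terminal nodes
labelled by tuples of terminal states. The empty interleaving is a single terminal node. -/
def interleaveFamily : {k : ℕ} → (Fin k → DecisionTree L) → DecisionTree (Fin k → L)
  | 0, _ => terminal Fin.elim0
  | _ + 1, t => ((t 0).interleave (interleaveFamily fun i => t i.succ)).map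
      fun p => Fin.cons p.1 p.2

end DecisionTree

/-- A finite tree-form decision problem, with set of terminal nodes `Z`: a tree whose terminal
nodes are labelled bijectively by `Z`. -/
structure DecisionProblem : Type 1 where
  Z : Type
  [fintypeZ : Fintype Z]
  [decEqZ : DecidableEq Z]
  tree : DecisionTree Z
  leafCount_eq_one : ∀ z, tree.leafCount z = 1

attribute [instance] DecisionProblem.fintypeZ DecisionProblem.decEqZ

namespace DecisionProblem

/-- The set `𝒳 ⊆ {0,1}^Z` of pure strategies in tree-form representation. -/
abbrev Pure (X : DecisionProblem) : Type := ↥X.tree.pureVectors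

/-- The convex hull `co 𝒳`. -/
abbrev Mixed (X : DecisionProblem) : Type := ↥X.tree.mixedVectors

instance instFinitePure (X : DecisionProblem) : Finite X.Pure :=
  X.tree.finite_pureVectors.to_subtype

instance instFintypePure (X : DecisionProblem) : Fintype X.Pure := Fintype.ofFinite _

/-- The inclusion `𝒳 → co 𝒳`. -/
def incl (X : DecisionProblem) (x : X.Pure) : X.Mixed :=
  ⟨x.1, subset_convexHull ℝ _ x.2⟩

end DecisionProblem

/-- Expectation of a vector-valued (or real-valued) function on a finite probability space. -/
def expect {Ω V : Type} [Fintype Ω] [AddCommMonoid V] [Module ℝ V] (p : PMF Ω) (f : Ω → V) : V :=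
  ∑ ω, (p ω).toReal • f ω

/-- The product distribution `⨂ i, p i`. -/
def productPMF {n : ℕ} {Ω : Fin n → Type} [∀ i, Fintype (Ω i)] (p : (i : Fin n) → PMF (Ω i)) :
    PMF ((i : Fin n) → Ω i) :=
  PMF.ofFintype (fun ω => ∏ i, p i (ω i)) (by
    rw [← Fintype.prod_sum]
    refine Finset.prod_eq_one fun i _ => ?_
    have h := (p i).tsum_coe
    rwa [tsum_fintype] at h)

/-- A class of deviations: a set `Φ X Y` of maps `𝒴 → co 𝒳` for all decision problems `X`, `Y`. -/
abbrev DeviationClass : Type 1 := (X Y : DecisionProblem) → Set (Y.Pure → X.Mixed)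

/-- The maps `𝒴 → co 𝒳` that are restrictions of linear maps. -/
def linearDeviations : DeviationClass := fun X Y =>
  {φ | ∃ T : (Y.Z → ℝ) →ₗ[ℝ] (X.Z → ℝ), ∀ y, (φ y : X.Z → ℝ) = T y}

/-- The `k`-mediator deviations `𝒴 → co 𝒳`: the maps `φ_q` that are induced by the (possibly
randomized) reduced strategies `q` in the interleaving of `X` with `k` copies of the dual
of `Y`. -/
def mediatorDeviations (k : ℕ) : DeviationClass := fun X Y =>
  {φ | ∃ q ∈ (X.tree.interleave
        (DecisionTree.interleaveFamily fun _ : Fin k => Y.tree.dual)).mixedVectors,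
      ∀ y z, (φ y : X.Z → ℝ) z = ∑ w : Fin k → Y.Z, q (z, w) * ∏ l, (y : Y.Z → ℝ) (w l)}

/-- An `n`-player game with tree-form strategy sets and multilinear utilities with values in
`[-1, 1]`. -/
structure Game (n : ℕ) : Type 1 where
  X : Fin n → DecisionProblem
  u : (i : Fin n) → MultilinearMap ℝ (fun j => (X j).Z → ℝ) ℝ
  abs_u_le_one : ∀ i (x : (j : Fin n) → (X j).Pure), |u i fun j => (x j : (X j).Z → ℝ)| ≤ 1

namespace Game

variable {n : ℕ}

/-- Utility of player `i` at a profile of points of `co 𝒳_1, …, co 𝒳_n`. -/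
def utility (G : Game n) (i : Fin n) (x : (j : Fin n) → (G.X j).Mixed) : ℝ :=
  G.u i fun j => (x j : (G.X j).Z → ℝ)

/-- A correlated profile: a distribution on `𝒳_1 × ⋯ × 𝒳_n`. -/
abbrev CorrelatedProfile (G : Game n) : Type := PMF ((i : Fin n) → (G.X i).Pure)

/-- `π` is an `ε`-`Φ`-equilibrium: no player gains more than `ε` by a deviation
`ψ : 𝒳_i → co 𝒳_i` in `Φ`. -/
def IsEquilibrium (G : Game n) (Φ : DeviationClass) (ε : ℝ) (π : G.CorrelatedProfile) : Prop :=
  ∀ i, ∀ ψ ∈ Φ (G.X i) (G.X i),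
    expect π (fun x => G.utility i (Function.update (fun j => (G.X j).incl (x j)) i (ψ (x i))))
      ≤ expect π (fun x => G.utility i fun j => (G.X j).incl (x j)) + ε

/-- A generalized profile `((𝒴_i, φ_i)_i, π)`. That the maps `φ_i` belong to the class `Φ` under
consideration is part of `GeneralizedProfile.IsEquilibrium`. -/
structure GeneralizedProfile (G : Game n) : Type 1 where
  Y : Fin n → DecisionProblem
  φ : (i : Fin n) → (Y i).Pure → (G.X i).Mixed
  π : PMF ((i : Fin n) → (Y i).Pure)

namespace GeneralizedProfile

variable {G : Game n}

/-- The profile of strategies that is played under the signals `y`. -/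
def play (P : G.GeneralizedProfile) (y : (i : Fin n) → (P.Y i).Pure) (i : Fin n) :
    (G.X i).Mixed :=
  P.φ i (y i)

/-- A generalized `ε`-`Φ`-equilibrium. -/
def IsEquilibrium (P : G.GeneralizedProfile) (Φ : DeviationClass) (ε : ℝ) : Prop :=
  (∀ i, P.φ i ∈ Φ (G.X i) (P.Y i)) ∧
  ∀ i, ∀ φ' ∈ Φ (G.X i) (P.Y i),
    expect P.π (fun y => G.utility i (Function.update (P.play y) i (φ' (y i))))
      ≤ expect P.π (fun y => G.utility i (P.play y)) + ε

/-- The canonical profile with distribution `π`: `𝒴_i = 𝒳_i` and `φ_i` is the identity. -/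
def canonical (π : G.CorrelatedProfile) : G.GeneralizedProfile where
  Y := G.X
  φ := fun i => (G.X i).incl
  π := π

/-- The joint law of the played strategies `(φ_1(y_1), …, φ_n(y_n))`, where `y ∼ π`. -/
def outcome (P : G.GeneralizedProfile) : PMF ((i : Fin n) → (G.X i).Mixed) :=
  P.π.map P.play

/-- Two generalized profiles are equivalent if the joint laws of the played strategies agree. -/
def Equivalent (P Q : G.GeneralizedProfile) : Prop :=
  P.outcome = Q.outcome

end GeneralizedProfile

end Game

/-- A strategy map, which turns points of `co 𝒳` into distributions on `𝒳`, for every decision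
problem. -/
abbrev StrategyMap : Type 1 := (X : DecisionProblem) → X.Mixed → PMF X.Pure

/-- A strategy map `δ` is consistent if the mean of `δ(x)` is `x`. -/
def StrategyMap.Consistent (δ : StrategyMap) : Prop :=
  ∀ X (x : X.Mixed), expect (δ X x) (fun x' => (x' : X.Z → ℝ)) = x

/-- The canonical profile that is induced by a generalized profile: the played strategies are
sampled, and each of them that is not pure is turned into pure strategies by `δ`, independently
for the players. -/
def Game.GeneralizedProfile.induced {n : ℕ} {G : Game n} (P : G.GeneralizedProfile)
    (δ : StrategyMap) : G.CorrelatedProfile :=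
  P.outcome.bind fun x => productPMF fun i => δ (G.X i) (x i)

/-- The revelation principle for `Φ` at accuracy `ε`: in every game, the canonical profile
induced by a generalized `ε`-`Φ`-equilibrium is an `ε`-`Φ`-equilibrium. -/
def SatisfiesRevelationPrinciple (δ : StrategyMap) (Φ : DeviationClass) (ε : ℝ) : Prop :=
  ∀ (n : ℕ) (G : Game n) (P : G.GeneralizedProfile),
    P.IsEquilibrium Φ ε → G.IsEquilibrium Φ ε (P.induced δ)

end TreeForm

end

/-! A recommended strategy is hidden in `k` additive secret shares. At each decision point `k`
elements of a cyclic group are drawn: uniform subject to summing to the recommended action if the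
strategy reaches the point, plainly uniform otherwise. In the signal problem `shareProblem` the
environment picks one share and walks down the tree, and the strategy announces that share at every
decision point on the way. With `k` mediators, one per share, all shares along the path being played
can be read and added, so the recommendation can be followed (`achieves_sharedStrategy`,
`recover_mem_mediatorDeviations`).

Conversely, `k` mediators learn nothing that a linear deviation does not already exploit. A
`k`-mediator deviation is a combination of products of `k` reads, each following one share down one
path. If some share is never read, the others look uniform and the mean of the product does not
depend on the strategy (`shareMean_eq_uniformMean`). Otherwise every share is read exactly once;
once two of the paths part, no subtree below sees all shares, so information survives only along the
common path and the mean is linear in the strategy vector (`linearInVector_shareMean_reach`).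
Averaging a mediator deviation over the shares therefore gives a linear deviation
(`meanDeviation_mem_linearDeviations`), with the same expected utility by multilinearity, and
linear-swap incentives carry over.

The revelation principle fails because the shared profile induces the original one back: the shares
recover pure strategies, and a consistent strategy map fixes those. In the matching game, two
uniform bits go to the first player and their parity to the second. Each bit alone is independent of
the parity, so linear deviations gain nothing, while two mediators can read both bits and play the
parity. -/

noncomputable section

/-! ### Moves and observations in interleaved trees -/

namespace TreeForm

namespace DecisionTree

variable {L M : Type}

/-- The root of the tree is not an observation point. -/
def NonObs : DecisionTree L → Prop
  | terminal _ => True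
  | decision _ => True
  | observation _ => False

/-- `Move t t'`: the root of `t` is a decision point and `t'` is one of its children. -/
inductive Move : DecisionTree L → DecisionTree L → Prop
  | mk {A : Type} [Fintype A] [Nonempty A] (c : A → DecisionTree L) (a : A) :
      Move (decision c) (c a)

/-- `Observe t d`: the root of `t` is an observation point with children `d`. -/
inductive Observe {B : Type} [Fintype B] : DecisionTree L → (B → DecisionTree L) → Prop
  | mk [Nonempty B] (d : B → DecisionTree L) : Observe (observation d) d

theorem Observe.nonempty {B : Type} [Fintype B] {t : DecisionTree L} {d : B → DecisionTree L}
    (h : Observe t d) : Nonempty B := by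
  cases h; assumption

theorem Move.nonObs {t t' : DecisionTree L} (h : Move t t') : t.NonObs := by
  cases h; trivial

theorem Move.map {t t' : DecisionTree L} (f : L → M) (h : Move t t') :
    Move (t.map f) (t'.map f) := by
  cases h with
  | mk c a => exact Move.mk (fun a => (c a).map f) a

theorem Observe.map {B : Type} [Fintype B] {t : DecisionTree L} {d : B → DecisionTree L}
    (f : L → M) (h : Observe t d) : Observe (t.map f) fun b => (d b).map f := by
  cases h with
  | mk d => exact Observe.mk (fun b => (d b).map f)

theorem NonObs.map {t : DecisionTree L} (f : L → M) (h : t.NonObs) : (t.map f).NonObs := by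
  cases t <;> trivial

theorem NonObs.interleave {s : DecisionTree L} {t : DecisionTree M} (hs : s.NonObs)
    (ht : t.NonObs) : (s.interleave t).NonObs := by
  cases s <;> cases t <;> first | exact hs.elim | exact ht.elim | trivial

theorem Move.interleave_left {s s' : DecisionTree L} (h : Move s s') {t : DecisionTree M}
    (ht : t.NonObs) : Move (s.interleave t) (s'.interleave t) := by
  cases h with
  | mk c a =>
    cases t with
    | terminal w =>
      rw [interleave_decision_terminal]
      exact Move.mk (fun a => (c a).interleave (terminal w)) a
    | decision d =>
      rw [interleave_decision_decision]
      exact Move.mk (Sum.elim (fun a => interleave (c a) (decision d))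
        (fun b => interleave (decision c) (d b))) (Sum.inl a)
    | observation d => exact ht.elim

theorem Move.interleave_right {t t' : DecisionTree M} (h : Move t t') {s : DecisionTree L}
    (hs : s.NonObs) : Move (s.interleave t) (s.interleave t') := by
  cases h with
  | mk d b =>
    cases s with
    | terminal z =>
      rw [interleave_terminal_decision]
      exact Move.mk (fun b => (terminal z).interleave (d b)) b
    | decision c =>
      rw [interleave_decision_decision]
      exact Move.mk (Sum.elim (fun a => interleave (c a) (decision d))
        (fun b => interleave (decision c) (d b))) (Sum.inr b)
    | observation d => exact hs.elim

theorem Observe.interleave_left {B : Type} [Fintype B] {s : DecisionTree L}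
    {c : B → DecisionTree L} (h : Observe s c) {t : DecisionTree M} (ht : t.NonObs) :
    Observe (s.interleave t) fun b => (c b).interleave t := by
  cases h with
  | mk c =>
    cases t with
    | terminal w => exact Observe.mk _
    | decision d => exact Observe.mk _
    | observation d => exact ht.elim

theorem Observe.interleave_right {B : Type} [Fintype B] {t : DecisionTree M}
    {d : B → DecisionTree M} (h : Observe t d) {s : DecisionTree L} (hs : s.NonObs) :
    Observe (s.interleave t) fun b => s.interleave (d b) := by
  cases h with
  | mk d =>
    cases s with
    | terminal w => exact Observe.mk _
    | decision d => exact Observe.mk _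
    | observation d => exact hs.elim

theorem NonObs.interleaveFamily {k : ℕ} {t : Fin k → DecisionTree L} (h : ∀ l, (t l).NonObs) :
    (interleaveFamily t).NonObs := by
  induction k with
  | zero => trivial
  | succ k ih => exact ((h 0).interleave (ih fun l => h l.succ)).map _

theorem Move.interleaveFamily {k : ℕ} {t : Fin k → DecisionTree L} {l : Fin k}
    {t' : DecisionTree L} (h : Move (t l) t') (ht : ∀ l, (t l).NonObs) :
    Move (interleaveFamily t) (interleaveFamily (Function.update t l t')) := by
  induction k with
  | zero => exact l.elim0
  | succ k ih =>
    refine Move.map _ ?_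
    cases l using Fin.cases with
    | zero =>
      have := h.interleave_left (NonObs.interleaveFamily fun l => ht l.succ)
      simpa [Function.update_of_ne] using this
    | succ l =>
      have := (ih (t := fun i => t i.succ) h fun l => ht l.succ).interleave_right (ht 0)
      have e (u : DecisionTree L) : (fun i : Fin k => Function.update t l.succ u i.succ) =
          Function.update (fun i => t i.succ) l u := by
        ext1 i
        simp [Function.update_apply, Fin.succ_inj]
      simpa only [e, Function.update_of_ne (Fin.succ_ne_zero l).symm] using this

theorem Observe.interleaveFamily {B : Type} [Fintype B] {k : ℕ} {t : Fin k → DecisionTree L}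
    {l : Fin k} {d : B → DecisionTree L} (h : Observe (t l) d)
    (ht : ∀ i ≠ l, (t i).NonObs) :
    Observe (interleaveFamily t) fun b => interleaveFamily (Function.update t l (d b)) := by
  induction k with
  | zero => exact l.elim0
  | succ k ih =>
    refine Observe.map (d := fun b => (Function.update t l (d b) 0).interleave
      (DecisionTree.interleaveFamily fun i => Function.update t l (d b) i.succ)) _ ?_
    cases l using Fin.cases with
    | zero =>
      have := h.interleave_left (NonObs.interleaveFamily fun l => ht l.succ (Fin.succ_ne_zero l))
      simpa [Function.update_of_ne] using this
    | succ l =>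
      have := (ih (t := fun i => t i.succ) h fun i hi =>
        ht i.succ (by simpa using hi)).interleave_right (ht 0 (Fin.succ_ne_zero l).symm)
      have e (u : DecisionTree L) : (fun i : Fin k => Function.update t l.succ u i.succ) =
          Function.update (fun i => t i.succ) l u := by
        ext1 i
        simp [Function.update_apply, Fin.succ_inj]
      simpa only [e, Function.update_of_ne (Fin.succ_ne_zero l).symm] using this

theorem interleaveFamily_terminal {k : ℕ} (w : Fin k → L) :
    interleaveFamily (fun l => terminal (w l)) = terminal w := by
  induction k with
  | zero =>
    exact congrArg terminal (Subsingleton.elim _ _)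
  | succ k ih =>
    rw [interleaveFamily, ih, interleave_terminal_terminal, map]
    exact congrArg terminal (Fin.cons_self_tail w)

/-- A strategy may commit to the move at the root; its actions below the other children are never
played and can be filled in arbitrarily. -/
theorem Move.pureVectors_subset [DecidableEq L] {t t' : DecisionTree L} (h : Move t t') :
    t'.pureVectors ⊆ t.pureVectors := by
  classical
  cases h with
  | mk c a =>
    rintro _ ⟨σ, rfl⟩
    have hne : ∀ b, Nonempty (c b).PureStrategy := by
      intro b
      induction c b with
      | terminal z => exact ⟨()⟩
      | @decision A _ _ c ih =>
        exact ⟨(Classical.arbitrary A, fun a => (ih a).some)⟩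
      | observation c ih => exact ⟨fun a => (ih a).some⟩
    refine ⟨(a, Function.update (fun b => (hne b).some) a σ), ?_⟩
    simp [vector]

theorem Observe.sum_mem_pureVectors [DecidableEq L] {B : Type} [Fintype B] {t : DecisionTree L}
    {d : B → DecisionTree L} (h : Observe t d) {v : B → L → ℝ}
    (hv : ∀ b, v b ∈ (d b).pureVectors) : ∑ b, v b ∈ t.pureVectors := by
  cases h with
  | mk d =>
    choose σ hσ using hv
    exact ⟨σ, Finset.sum_congr rfl fun b _ => hσ b⟩

theorem nonObs_of_reflTransGen_move {d d' : DecisionTree L} (h : Relation.ReflTransGen Move d d')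
    (hd' : d'.NonObs) : d.NonObs := by
  rcases h.cases_head with rfl | ⟨e, he, -⟩
  · exact hd'
  · exact he.nonObs

/-! ### Vectors obtainable by consulting several mediators -/

section Achieves

variable {Z W H : Type} [DecidableEq Z] [DecidableEq W] [Fintype W] {k : ℕ}

/-- `Achieves η t D F`: some pure strategy of the interleaving of `t` with the family `D` yields
the vector `F h` in `t` whenever the reach probabilities of the terminal nodes of the members of
`D` are `η h`. -/
def Achieves (η : H → W → ℝ) (t : DecisionTree Z) (D : Fin k → DecisionTree W)
    (F : H → Z → ℝ) : Prop :=
  ∃ v ∈ (t.interleave (interleaveFamily D)).pureVectors,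
    ∀ h z, ∑ w, v (z, w) * ∏ l, η h (w l) = F h z

variable {η : H → W → ℝ} {t : DecisionTree Z} {D : Fin k → DecisionTree W} {F : H → Z → ℝ}

theorem Achieves.of_move {T T' : DecisionTree (Z × (Fin k → W))} (h : Move T T')
    (hT : ∃ v ∈ T'.pureVectors, ∀ h z, ∑ w, v (z, w) * ∏ l, η h (w l) = F h z) :
    ∃ v ∈ T.pureVectors, ∀ h z, ∑ w, v (z, w) * ∏ l, η h (w l) = F h z := by
  obtain ⟨v, hv, h'⟩ := hT
  exact ⟨v, h.pureVectors_subset hv, h'⟩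

/-- The vector at an observation point is the sum over the branches, and evaluation at `η h` is
linear in the vector, so the achieved functions add up. -/
theorem Achieves.of_observe {B : Type} [Fintype B] {T : DecisionTree (Z × (Fin k → W))}
    {d : B → DecisionTree (Z × (Fin k → W))} {F : B → H → Z → ℝ} (h : Observe T d)
    (hT : ∀ b, ∃ v ∈ (d b).pureVectors,
      ∀ h z, ∑ w, v (z, w) * ∏ l, η h (w l) = F b h z) :
    ∃ v ∈ T.pureVectors, ∀ h z, ∑ w, v (z, w) * ∏ l, η h (w l) = (∑ b, F b) h z := by
  choose v hv h' using hT
  refine ⟨_, h.sum_mem_pureVectors hv, fun i z => ?_⟩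
  simp only [Finset.sum_apply, Finset.sum_mul, ← h']
  exact Finset.sum_comm

theorem Achieves.decision {A : Type} [Fintype A] [Nonempty A] {c : A → DecisionTree Z} (a : A)
    (hD : ∀ l, (D l).NonObs) (h : Achieves η (c a) D F) :
    Achieves η (DecisionTree.decision c) D F :=
  Achieves.of_move ((Move.mk c a).interleave_left (NonObs.interleaveFamily hD)) h

theorem Achieves.observation {A : Type} [Fintype A] [Nonempty A] {c : A → DecisionTree Z}
    {F : A → H → Z → ℝ} (hD : ∀ l, (D l).NonObs) (h : ∀ a, Achieves η (c a) D (F a)) :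
    Achieves η (DecisionTree.observation c) D (∑ a, F a) :=
  Achieves.of_observe ((Observe.mk c).interleave_left (NonObs.interleaveFamily hD)) h

theorem Achieves.update_move (ht : t.NonObs) (hD : ∀ l, (D l).NonObs) {l : Fin k}
    {d : DecisionTree W} (hm : Move (D l) d)
    (h : Achieves η t (Function.update D l d) F) : Achieves η t D F :=
  Achieves.of_move ((hm.interleaveFamily hD).interleave_right ht) h

theorem Achieves.update_observe {B : Type} [Fintype B] {F : B → H → Z → ℝ} (ht : t.NonObs)
    {l : Fin k} (hD : ∀ i ≠ l, (D i).NonObs) {d : B → DecisionTree W} (hm : Observe (D l) d)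
    (h : ∀ b, Achieves η t (Function.update D l (d b)) (F b)) : Achieves η t D (∑ b, F b) :=
  Achieves.of_observe ((hm.interleaveFamily hD).interleave_right ht) h

theorem achieves_terminal (η : H → W → ℝ) (z : Z) (w : Fin k → W) :
    Achieves η (terminal z) (fun l => terminal (w l))
      fun h => Pi.single z (∏ l, η h (w l)) := by
  refine ⟨Pi.single (z, w) 1, ?_, fun h z' => ?_⟩
  · rw [interleaveFamily_terminal, interleave_terminal_terminal]
    exact ⟨(), rfl⟩
  · rcases eq_or_ne z' z with rfl | hz
    · simp [Pi.single_apply]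
    · simp [hz]

theorem Achieves.update_moves (ht : t.NonObs) {l : Fin k} (hD : ∀ i ≠ l, (D i).NonObs)
    {d d' : DecisionTree W} (hm : Relation.ReflTransGen Move d d')
    (h : Achieves η t (Function.update D l d') F) : Achieves η t (Function.update D l d) F := by
  induction hm using Relation.ReflTransGen.head_induction_on with
  | refl => exact h
  | @head e e' he _ ih =>
    refine Achieves.update_move (l := l) (d := e') ht (fun i => ?_) (by simpa using he)
      (by simpa using ih)
    rcases eq_or_ne i l with rfl | hi
    · simpa using he.nonObs
    · simpa [hi] using hD i hi

/-- The members are advanced one after another, `S` being the set of those still to be moved. No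
member is at an observation point meanwhile: either it still has a move to make or it has arrived at
`D' l`. -/
theorem Achieves.moves (ht : t.NonObs) {D' : Fin k → DecisionTree W}
    (hm : ∀ l, Relation.ReflTransGen Move (D l) (D' l)) (hD' : ∀ l, (D' l).NonObs)
    (h : Achieves η t D' F) : Achieves η t D F := by
  suffices ∀ S : Finset (Fin k), Achieves η t (fun l => if l ∈ S then D l else D' l) F by
    simpa using this Finset.univ
  intro S
  induction S using Finset.induction_on with
  | empty => simpa using h
  | insert l S hl ih =>
    have hn : ∀ i, (if i ∈ S then D i else D' i).NonObs := by
      intro i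
      split_ifs
      · exact nonObs_of_reflTransGen_move (hm i) (hD' i)
      · exact hD' i
    have e1 : (fun i => if i ∈ insert l S then D i else D' i) =
        Function.update (fun i => if i ∈ S then D i else D' i) l (D l) := by
      ext1 i
      rcases eq_or_ne i l with rfl | hi
      · simp
      · simp [hi]
    have e2 : (fun i => if i ∈ S then D i else D' i) =
        Function.update (fun i => if i ∈ S then D i else D' i) l (D' l) := by
      ext1 i
      rcases eq_or_ne i l with rfl | hi
      · simp [hl]
      · simp [hi]
    rw [e1]
    rw [e2] at ih
    exact Achieves.update_moves ht (fun i _ => hn i) (hm l) ih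

/-- The player moves every member of the family to an observation point and collects the
answers. -/
theorem Achieves.gather {A : Type} [Fintype A] [DecidableEq A] (ht : t.NonObs)
    {O : Fin k → DecisionTree W} {E : Fin k → A → DecisionTree W} {F : (Fin k → A) → H → Z → ℝ}
    (hm : ∀ l, Move (D l) (O l)) (hO : ∀ l, Observe (O l) (E l)) (hE : ∀ l a, (E l a).NonObs)
    (h : ∀ s, Achieves η t (fun l => E l (s l)) (F s)) : Achieves η t D (∑ s, F s) := by
  -- A dummy: when `S` is everything, no answer is prescribed yet.
  let s₀ : Fin k → A := fun l => (hO l).nonempty.some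
  -- Induction on the set `S` of members not yet asked, with the answers outside `S` already fixed
  -- by `s`. Members are asked one at a time, so that only one of them is ever at an observation
  -- point.
  suffices ∀ (S : Finset (Fin k)) (s : Fin k → A),
      Achieves η t (fun l => if l ∈ S then D l else E l (s l))
        (∑ s' ∈ Finset.univ.filter fun s' => ∀ l ∉ S, s' l = s l, F s') by
    simpa using this Finset.univ s₀
  intro S
  induction S using Finset.induction_on with
  | empty =>
    intro s
    have : (Finset.univ.filter fun s' : Fin k → A => ∀ l ∉ (∅ : Finset (Fin k)), s' l = s l)
        = {s} := by
      ext s'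
      simp [funext_iff]
    rw [this, Finset.sum_singleton]
    simpa using h s
  | insert l S hl ih =>
    intro s
    have hn : ∀ i, (if i ∈ insert l S then D i else E i (s i)).NonObs := by
      intro i
      split_ifs
      · exact (hm i).nonObs
      · exact hE i _
    refine Achieves.update_move ht hn (l := l) (d := O l) (by simpa using hm l) ?_
    have e : (∑ s' ∈ Finset.univ.filter fun s' => ∀ i ∉ insert l S, s' i = s i, F s') =
        ∑ b, ∑ s' ∈ Finset.univ.filter fun s' => ∀ i ∉ S, s' i = Function.update s l b i,
          F s' := by
      rw [← Finset.sum_fiberwise _ (fun s' : Fin k → A => s' l)]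
      refine Finset.sum_congr rfl fun b _ => Finset.sum_congr ?_ fun _ _ => rfl
      ext s'
      simp only [Finset.mem_filter, Finset.mem_univ, true_and, Finset.mem_insert, not_or]
      constructor
      · rintro ⟨h1, rfl⟩ i hi
        rcases eq_or_ne i l with rfl | hil
        · simp
        · simpa [hil] using h1 i ⟨hil, hi⟩
      · intro h1
        refine ⟨fun i hi => ?_, by simpa using h1 l hl⟩
        simpa [hi.1] using h1 i hi.2
    rw [e]
    refine Achieves.update_observe ht (l := l) (d := E l) (fun i hi => ?_)
      (by simpa using hO l) fun b => ?_
    · simpa [hi] using hn i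
    · convert ih (Function.update s l b) using 2 with i
      rcases eq_or_ne i l with rfl | hi
      · simp [hl]
      · simp [hi]

end Achieves

end DecisionTree

end TreeForm

end

/-! ### Secret sharing along a decision tree -/

noncomputable section

namespace TreeForm

/-- A bijection of a nonempty finite type with a cyclic group. -/
def cyclicEquiv (A : Type) [Fintype A] [Nonempty A] : A ≃ ZMod (Fintype.card A) :=
  haveI : NeZero (Fintype.card A) := ⟨Fintype.card_ne_zero⟩
  Fintype.equivOfCardEq (ZMod.card _).symm

/-- The secret that is shared by the `k` shares `s`. -/
def secret {A : Type} [Fintype A] [Nonempty A] {k : ℕ} (s : Fin k → A) : A :=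
  (cyclicEquiv A).symm (∑ j, cyclicEquiv A (s j))

namespace DecisionTree

variable {L W : Type}

/-- The terminal nodes of `shareTree t`: a path in `t`, together with a share at each decision
point of the path. -/
def SharePath : DecisionTree L → Type
  | terminal _ => Unit
  | @decision _ A _ _ c => A × Σ b : A, SharePath (c b)
  | @observation _ A _ _ c => Σ a : A, SharePath (c a)

instance instFintypeSharePath : (t : DecisionTree L) → Fintype t.SharePath
  | terminal _ => inferInstanceAs (Fintype Unit)
  | @decision _ A _ _ c =>
      haveI := fun b => instFintypeSharePath (c b)
      inferInstanceAs (Fintype (A × Σ b : A, SharePath (c b)))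
  | @observation _ A _ _ c =>
      haveI := fun b => instFintypeSharePath (c b)
      inferInstanceAs (Fintype (Σ b : A, SharePath (c b)))

instance instDecidableEqSharePath (t : DecisionTree L) : DecidableEq t.SharePath :=
  Classical.decEq _

theorem sum_sharePath_terminal {R : Type*} [AddCommMonoid R] (z : L)
    (g : (terminal z).SharePath → R) : ∑ q, g q = g () :=
  Finset.sum_singleton g ()

theorem sum_sharePath_decision {R : Type*} [AddCommMonoid R] {A : Type} [Fintype A] [Nonempty A]
    (c : A → DecisionTree L) (g : (decision c).SharePath → R) :
    ∑ q, g q = ∑ s, ∑ b, ∑ q, g (s, ⟨b, q⟩) :=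
  (Fintype.sum_prod_type (α₁ := A) (α₂ := Σ b : A, (c b).SharePath) g).trans
    (Finset.sum_congr rfl fun s _ => Fintype.sum_sigma fun q => g (s, q))

theorem sum_sharePath_observation {R : Type*} [AddCommMonoid R] {A : Type} [Fintype A]
    [Nonempty A] (c : A → DecisionTree L) (g : (observation c).SharePath → R) :
    ∑ q, g q = ∑ b, ∑ q, g ⟨b, q⟩ :=
  Fintype.sum_sigma (ι := A) (α := fun b => (c b).SharePath) g

open Classical in
/-- The indicator that the share assignment `ρ` plays all shares on the path. -/
def reach : (t : DecisionTree L) → t.PureStrategy → t.SharePath → ℝ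
  | terminal _, _, _ => 1
  | decision c, ρ, q => (if q.1 = ρ.1 then 1 else 0) * reach (c q.2.1) (ρ.2 q.2.1) q.2.2
  | observation c, ρ, q => reach (c q.1) (ρ q.1) q.2

/-- The strategy that is shared by the share assignments `ρ j`. -/
def sharedStrategy {k : ℕ} : (t : DecisionTree L) → (Fin k → t.PureStrategy) → t.PureStrategy
  | terminal _, _ => ()
  | decision c, ρ => (secret fun j => (ρ j).1, fun b => sharedStrategy (c b) fun j => (ρ j).2 b)
  | observation c, ρ => fun a => sharedStrategy (c a) fun j => ρ j a

/-- The tree `t`, where each decision point is replaced by the announcement of a share, after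
which the environment chooses the action. -/
def shareTree : (t : DecisionTree L) → (t.SharePath → W) → DecisionTree W
  | terminal _, f => terminal (f ())
  | @decision _ A _ _ c, f => observation fun _ : Unit => decision fun s : A =>
      observation fun b : A => shareTree (c b) fun q => f (s, ⟨b, q⟩)
  | @observation _ A _ _ c, f => observation fun a : A => shareTree (c a) fun q => f ⟨a, q⟩

theorem leafCount_shareTree [DecidableEq W] (t : DecisionTree L) (f : t.SharePath → W) (w : W) :
    (shareTree t f).leafCount w = ∑ q, if f q = w then 1 else 0 := by
  induction t with
  | terminal z => simp only [shareTree, leafCount, sum_sharePath_terminal]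
  | decision c ih =>
    simp only [shareTree, leafCount, ih, sum_sharePath_decision, Finset.univ_unique, Finset.sum_singleton]
  | observation c ih =>
    simp only [shareTree, leafCount, ih, sum_sharePath_observation]

/-- What a strategy would do after a share that it does not announce leaves no trace in its vector,
so one share per decision point of `t` suffices to describe it. -/
theorem exists_vector_shareTree [DecidableEq W] (t : DecisionTree L) (f : t.SharePath → W)
    (σ : (shareTree t f).PureStrategy) :
    ∃ ρ, ∀ w, (shareTree t f).vector σ w = ∑ q, if f q = w then reach t ρ q else 0 := by
  classical
  induction t with
  | terminal z =>
    refine ⟨(), fun w => Eq.trans ?_ (sum_sharePath_terminal z _).symm⟩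
    simp only [shareTree, vector, reach, Pi.single_apply]
    exact if_congr eq_comm rfl rfl
  | decision c ih =>
    choose ρ hρ using fun b => ih b _ ((σ ()).2 (σ ()).1 b)
    refine ⟨((σ ()).1, ρ), fun w => Eq.trans ?_ (sum_sharePath_decision c _).symm⟩
    rw [Finset.sum_eq_single (σ ()).1]
    · simp [shareTree, vector, reach, hρ, Finset.sum_apply]
    · intro s _ hs
      exact Finset.sum_eq_zero fun b _ => Finset.sum_eq_zero fun q _ => by simp [reach, hs]
    · simp
  | observation c ih =>
    choose ρ hρ using fun b => ih b _ (σ b)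
    refine ⟨ρ, fun w => Eq.trans ?_ (sum_sharePath_observation c _).symm⟩
    simp [shareTree, vector, reach, hρ, Finset.sum_apply]

theorem exists_strategy_shareTree [DecidableEq W] (t : DecisionTree L) (f : t.SharePath → W)
    (ρ : t.PureStrategy) :
    ∃ σ, ∀ w, (shareTree t f).vector σ w = ∑ q, if f q = w then reach t ρ q else 0 := by
  classical
  induction t with
  | terminal z =>
    refine ⟨(), fun w => Eq.trans ?_ (sum_sharePath_terminal z _).symm⟩
    simp only [shareTree, vector, reach, Pi.single_apply]
    exact if_congr eq_comm rfl rfl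
  | decision c ih =>
    choose σ hσ using fun s b => ih b (fun q => f (s, ⟨b, q⟩)) (ρ.2 b)
    refine ⟨fun _ => (ρ.1, σ), fun w => Eq.trans ?_ (sum_sharePath_decision c _).symm⟩
    rw [Finset.sum_eq_single ρ.1]
    · simp [shareTree, vector, reach, hσ, Finset.sum_apply]
    · intro s _ hs
      exact Finset.sum_eq_zero fun b _ => Finset.sum_eq_zero fun q _ => by simp [reach, hs]
    · simp
  | observation c ih =>
    choose σ hσ using fun b => ih b (fun q => f ⟨b, q⟩) (ρ b)
    refine ⟨σ, fun w => Eq.trans ?_ (sum_sharePath_observation c _).symm⟩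
    simp [shareTree, vector, reach, hσ, Finset.sum_apply]

/-- With access to all shares, the mediators can be used to play the shared strategy. -/
theorem achieves_sharedStrategy {H : Type} {k : ℕ} [DecidableEq L] [DecidableEq W] [Fintype W]
    {η : H → W → ℝ} (t : DecisionTree L) (f : Fin k → t.SharePath → W) (r : H → Fin k → ℝ)
    (ρ : H → Fin k → t.PureStrategy)
    (hη : ∀ h l q, η h (f l q) = r h l * reach t (ρ h l) q) (D : Fin k → DecisionTree W)
    (hD : ∀ l, Relation.ReflTransGen Move (D l) (shareTree t (f l)).dual) :
    Achieves η t D fun h => (∏ l, r h l) • vector t (sharedStrategy t (ρ h)) := by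
  classical
  -- Two things vary in the induction. The factor `r h l` records whether share `l` agreed with the
  -- answers received so far. The family `D` may lag behind the current subtree: mediators cannot be
  -- moved while `t` is at an observation point, so pending moves are stored in `hD`.
  induction t generalizing H r D with
  | terminal z =>
    refine Achieves.moves (D' := fun l => terminal (f l ())) trivial hD (fun _ => trivial) ?_
    convert achieves_terminal η z (fun l => f l ()) using 2 with h
    have e : ∀ l, η h (f l ()) = r h l := fun l => (hη h l ()).trans (mul_one _)
    simp only [vector, e]
    ext z'
    rcases eq_or_ne z' z with rfl | hz
    · simp
    · simp [hz]
  | @decision A _ _ c ih =>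
    refine Achieves.moves (D' := fun l => (shareTree (decision c) (f l)).dual) trivial hD
      (fun _ => trivial) ?_
    have key := Achieves.gather (η := η) (t := decision c)
      (D := fun l => (shareTree (decision c) (f l)).dual)
      (F := fun (s : Fin k → A) h =>
        (∏ l, r h l * (if s l = (ρ h l).1 then 1 else 0)) •
          vector (c (secret s)) (sharedStrategy (c (secret s)) fun l => (ρ h l).2 (secret s)))
      trivial (fun l => Move.mk _ ()) (fun l => Observe.mk _) (fun l s => trivial) ?_
    · convert key using 2 with h
      -- All answer tuples other than the true shares have an indicator factor equal to zero.
      rw [Finset.sum_apply, Finset.sum_eq_single fun l => (ρ h l).1]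
      · simp [vector, sharedStrategy]
      · intro s _ hs
        obtain ⟨l, hl⟩ := Function.ne_iff.1 hs
        rw [Finset.prod_eq_zero (Finset.mem_univ l) (by simp [hl]), zero_smul]
      · simp
    · intro s
      refine Achieves.decision (secret s) (fun l => trivial) ?_
      refine ih (secret s) (fun l q => f l (s l, ⟨secret s, q⟩))
        (fun h l => r h l * if s l = (ρ h l).1 then 1 else 0)
        (fun h l => (ρ h l).2 (secret s)) (fun h l q => ?_) _ fun l => ?_
      · exact (hη h l (s l, ⟨secret s, q⟩)).trans (mul_assoc _ _ _).symm
      · exact Relation.ReflTransGen.single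
          (Move.mk (fun b => (shareTree (c b) fun q => f l (s l, ⟨b, q⟩)).dual) (secret s))
  | @observation A _ _ c ih =>
    have key := Achieves.observation (η := η) (c := c) (D := D)
      (F := fun a h => (∏ l, r h l) • vector (c a) (sharedStrategy (c a) fun l => ρ h l a))
      (fun l => nonObs_of_reflTransGen_move (hD l) trivial) ?_
    · convert key using 2 with h
      simp [vector, sharedStrategy, Finset.smul_sum]
    · intro a
      refine ih a (fun l q => f l ⟨a, q⟩) r (fun h l => ρ h l a) (fun h l q => ?_) D fun l => ?_
      · exact hη h l ⟨a, q⟩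
      -- Following the environment's choice `a` is one more pending move for every mediator.
      · exact (hD l).tail (Move.mk (fun a => (shareTree (c a) fun q => f l ⟨a, q⟩).dual) a)

end DecisionTree

end TreeForm

end

/-! ### Uniformity of incomplete shares and factorization of sums -/

noncomputable section

namespace TreeForm

/-- Translating share `j₀` by a group element carries one value of the secret to another and leaves
`f` unchanged. All secrets thus get the same sum: without share `j₀`, the secret is invisible. -/
theorem sum_secret_eq {A : Type} [Fintype A] [Nonempty A] [DecidableEq A] {k : ℕ} (j₀ : Fin k)
    (f : (Fin k → A) → ℝ) (hf : ∀ s b, f (Function.update s j₀ b) = f s) (a : A) :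
    (Fintype.card A : ℝ) * ∑ s, (if secret s = a then f s else 0) = ∑ s, f s := by
  have key : ∀ a', ∑ s, (if secret s = a' then f s else 0) =
      ∑ s, if secret s = a then f s else 0 := by
    intro a'
    set e := cyclicEquiv A
    let shift : A ≃ A := (e.trans (Equiv.addRight (e a - e a'))).trans e.symm
    let E : (Fin k → A) ≃ (Fin k → A) :=
      Equiv.piCongrRight fun j => if j = j₀ then shift else Equiv.refl A
    have hE : ∀ s, E s = Function.update s j₀ (shift (s j₀)) := by
      intro s
      ext1 j
      rcases eq_or_ne j j₀ with rfl | hj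
      · simp [E]
      · simp [E, hj]
    refine Fintype.sum_equiv E _ _ fun s => ?_
    rw [hE, hf]
    refine if_congr ?_ rfl rfl
    have h1 : ∑ j, e (Function.update s j₀ (shift (s j₀)) j) = ∑ j, e (s j) + (e a - e a') := by
      rw [← Finset.add_sum_erase _ _ (Finset.mem_univ j₀),
        ← Finset.add_sum_erase _ (fun j => e (s j)) (Finset.mem_univ j₀)]
      have : ∑ j ∈ Finset.univ.erase j₀, e (Function.update s j₀ (shift (s j₀)) j) =
          ∑ j ∈ Finset.univ.erase j₀, e (s j) :=
        Finset.sum_congr rfl fun j hj => by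
          rw [Function.update_of_ne (Finset.ne_of_mem_erase hj)]
      rw [this]
      simp only [Function.update_self, shift, Equiv.trans_apply, Equiv.coe_addRight,
        Equiv.apply_symm_apply]
      abel
    rw [secret, secret, h1, Equiv.symm_apply_eq, Equiv.symm_apply_eq]
    constructor
    · intro h; rw [h]; abel
    · intro h
      rw [← sub_eq_zero] at h ⊢
      rw [← h]; abel
  calc (Fintype.card A : ℝ) * ∑ s, (if secret s = a then f s else 0)
      = ∑ a' : A, ∑ s, (if secret s = a' then f s else 0) := by
        simp [key]
    _ = ∑ s, f s := by
        rw [Finset.sum_comm]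
        simp

theorem sum_pi_prod {B ι : Type} [Fintype B] [DecidableEq B] [Fintype ι] [DecidableEq ι]
    {P : B → Type} [∀ b, Fintype (P b)]
    (g : (b : B) → (ι → P b) → ℝ) :
    ∑ σ : ι → (b : B) → P b, ∏ b, g b (fun j => σ j b) = ∏ b, ∑ τ, g b τ := by
  rw [Fintype.prod_sum]
  exact Fintype.sum_equiv (Equiv.piComm fun _ b => P b) _ _ fun σ => rfl

theorem sum_prod_pi_prod {A B ι : Type} [Fintype A] [Fintype B] [DecidableEq B] [Fintype ι]
    [DecidableEq ι] {P : B → Type} [∀ b, Fintype (P b)] (f : (ι → A) → ℝ) (g : (b : B) → (ι → P b) → ℝ) :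
    ∑ σ : ι → A × ((b : B) → P b), f (fun j => (σ j).1) * ∏ b, g b (fun j => (σ j).2 b) =
      (∑ s, f s) * ∏ b, ∑ τ, g b τ := by
  rw [← sum_pi_prod, Finset.sum_mul_sum, ← Fintype.sum_prod_type']
  exact Fintype.sum_equiv (Equiv.arrowProdEquivProdArrow ι (fun _ => A)
    (fun _ => (b : B) → P b)) _ _ fun σ => rfl

namespace DecisionTree

variable {L : Type}

instance instFintypePureStrategy (t : DecisionTree L) : Fintype t.PureStrategy :=
  Fintype.ofFinite _

theorem exists_vector_eq_natCast [DecidableEq L] (t : DecisionTree L) (σ : t.PureStrategy)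
    (z : L) : ∃ n : ℕ, t.vector σ z = n ∧ n ≤ t.leafCount z := by
  induction t with
  | terminal w =>
    refine ⟨if w = z then 1 else 0, ?_, le_rfl⟩
    simp [vector, Pi.single_apply, eq_comm]
  | decision c ih =>
    obtain ⟨n, h1, h2⟩ := ih σ.1 (σ.2 σ.1)
    exact ⟨n, h1, h2.trans
      (Finset.single_le_sum (f := fun a => (c a).leafCount z) (fun _ _ => Nat.zero_le _)
        (Finset.mem_univ σ.1))⟩
  | observation c ih =>
    choose n h1 h2 using fun a => ih a (σ a)
    refine ⟨∑ a, n a, ?_, Finset.sum_le_sum fun a _ => h2 a⟩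
    simp [vector, Finset.sum_apply, h1]

theorem vector_eq_zero_of_leafCount [DecidableEq L] {t : DecisionTree L} {z : L}
    (h : t.leafCount z = 0) (σ : t.PureStrategy) : t.vector σ z = 0 := by
  obtain ⟨n, h1, h2⟩ := t.exists_vector_eq_natCast σ z
  rw [h1, show n = 0 by omega, Nat.cast_zero]

theorem leafCount_child_eq_zero {A : Type} [Fintype A] [DecidableEq L] {c : A → DecisionTree L}
    {z : L} (h : ∑ a, (c a).leafCount z ≤ 1) {a b : A} (ha : (c a).leafCount z ≠ 0)
    (hb : b ≠ a) : (c b).leafCount z = 0 := by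
  classical
  have h1 : (c a).leafCount z + (c b).leafCount z ≤ ∑ a, (c a).leafCount z := by
    rw [← Finset.sum_pair (f := fun a => (c a).leafCount z) hb.symm]
    exact Finset.sum_le_sum_of_subset (Finset.subset_univ _)
  omega

theorem leafCount_decision_child_le [DecidableEq L] {A : Type} [Fintype A] [Nonempty A]
    {c : A → DecisionTree L} {z : L} (a : A) :
    (c a).leafCount z ≤ (decision c).leafCount z :=
  Finset.single_le_sum (f := fun a => (c a).leafCount z) (fun _ _ => Nat.zero_le _)
    (Finset.mem_univ a)

theorem leafCount_observation_child_le [DecidableEq L] {A : Type} [Fintype A] [Nonempty A]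
    {c : A → DecisionTree L} {z : L} (a : A) :
    (c a).leafCount z ≤ (observation c).leafCount z :=
  Finset.single_le_sum (f := fun a => (c a).leafCount z) (fun _ _ => Nat.zero_le _)
    (Finset.mem_univ a)

/-! ### Linear functions of the strategy vector -/

section Linear

variable [Fintype L] [DecidableEq L]

/-- `F` is a linear function of the vector of the strategy. -/
def LinearInVector (t : DecisionTree L) (F : t.PureStrategy → ℝ) : Prop :=
  ∃ g : L → ℝ, ∀ ξ, F ξ = ∑ z, g z * t.vector ξ z

theorem LinearInVector.const_mul {t : DecisionTree L} {F : t.PureStrategy → ℝ}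
    (h : t.LinearInVector F) (r : ℝ) : t.LinearInVector fun ξ => r * F ξ := by
  obtain ⟨g, hg⟩ := h
  exact ⟨fun z => r * g z, fun ξ => by simp only [hg, Finset.mul_sum, mul_assoc]⟩

/-- Each label lies below at most one child, so the coefficients of the children can be glued
together; children that are not played have zero coordinates. The bound `≤ 1`, unlike equality,
passes to subtrees. -/
theorem LinearInVector.decision {A : Type} [Fintype A] [Nonempty A] {c : A → DecisionTree L}
    (hc : ∀ z, (decision c).leafCount z ≤ 1) {F : (a : A) → (c a).PureStrategy → ℝ}
    (h : ∀ a, (c a).LinearInVector (F a)) :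
    (DecisionTree.decision c).LinearInVector fun ξ => F ξ.1 (ξ.2 ξ.1) := by
  choose g hg using h
  refine ⟨fun z => ∑ a, if (c a).leafCount z = 0 then 0 else g a z, fun ξ => ?_⟩
  refine (hg _ _).trans (Finset.sum_congr rfl fun z _ => ?_)
  obtain ⟨a, ξ⟩ := ξ
  change _ = _ * (c a).vector (ξ a) z
  by_cases h0 : (c a).leafCount z = 0
  · rw [vector_eq_zero_of_leafCount h0]; simp
  · congr 1
    change _ = ∑ a, _
    rw [Finset.sum_eq_single a]
    · simp [h0]
    · intro b _ hb
      simp [leafCount_child_eq_zero (hc z) h0 hb]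
    · simp

theorem LinearInVector.observation {A : Type} [Fintype A] [Nonempty A]
    {c : A → DecisionTree L} (hc : ∀ z, (observation c).leafCount z ≤ 1) (a : A)
    {F : (c a).PureStrategy → ℝ} (h : (c a).LinearInVector F) :
    (DecisionTree.observation c).LinearInVector fun ξ => F (ξ a) := by
  obtain ⟨g, hg⟩ := h
  refine ⟨fun z => if (c a).leafCount z = 0 then 0 else g z, fun ξ => ?_⟩
  refine (hg _).trans (Finset.sum_congr rfl fun z _ => ?_)
  simp only [vector, Finset.sum_apply]
  by_cases h0 : (c a).leafCount z = 0
  · rw [vector_eq_zero_of_leafCount h0]; simp [h0]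
  · rw [if_neg h0, Finset.sum_eq_single a]
    · intro b _ hb
      exact vector_eq_zero_of_leafCount (leafCount_child_eq_zero (hc z) h0 hb) _
    · simp

/-- If the environment's choices are fixed, exactly one compatible terminal node is reached, so the
coordinates of the compatible nodes sum to one. -/
theorem linearInVector_const {t : DecisionTree L} (ht : ∀ z, t.leafCount z ≤ 1) (r : ℝ) :
    t.LinearInVector fun _ => r := by
  induction t with
  | terminal z =>
    exact ⟨fun _ => r, fun ξ => by simp [vector, Pi.single_apply]⟩
  | decision c ih =>
    exact LinearInVector.decision ht fun a =>
      ih a fun z => (leafCount_decision_child_le a).trans (ht z)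
  | @observation A _ _ c ih =>
    exact LinearInVector.observation ht (Classical.arbitrary A)
      (ih _ fun z => (leafCount_observation_child_le _).trans (ht z))

end Linear

/-! ### Random shares and the means of queries -/

section Weights

variable {k : ℕ}

variable (k) in
/-- The probability of each assignment of `k` shares under the uniform distribution. -/
def uniformWeight : DecisionTree L → ℝ
  | terminal _ => 1
  | @decision _ A _ _ c => ((Fintype.card A : ℝ) ^ k)⁻¹ * ∏ a, uniformWeight (c a)
  | observation c => ∏ a, uniformWeight (c a)

open Classical in
/-- The distribution of a share assignment for the strategy `ξ`: the shares at the decision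
points that are reached by `ξ` are uniform given that the secret is the action of `ξ`, all other
shares are uniform. -/
def shareWeight : (t : DecisionTree L) → t.PureStrategy → (Fin k → t.PureStrategy) → ℝ
  | terminal _, _, _ => 1
  | @decision _ A _ _ c, ξ, σ =>
      (if secret (fun j => (σ j).1) = ξ.1 then
        (Fintype.card A : ℝ) * ((Fintype.card A : ℝ) ^ k)⁻¹ else 0) *
      ∏ b, if b = ξ.1 then shareWeight (c b) (ξ.2 b) (fun j => (σ j).2 b)
        else uniformWeight k (c b)
  | observation c, ξ, σ => ∏ a, shareWeight (c a) (ξ a) fun j => σ j a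

theorem uniformWeight_nonneg (t : DecisionTree L) : 0 ≤ uniformWeight k t := by
  induction t with
  | terminal z => exact zero_le_one
  | decision c ih => exact mul_nonneg (by positivity) (Finset.prod_nonneg fun a _ => ih a)
  | observation c ih => exact Finset.prod_nonneg fun a _ => ih a

theorem shareWeight_nonneg (t : DecisionTree L) (ξ : t.PureStrategy)
    (σ : Fin k → t.PureStrategy) : 0 ≤ t.shareWeight ξ σ := by
  induction t with
  | terminal z => exact zero_le_one
  | decision c ih =>
    refine mul_nonneg ?_ (Finset.prod_nonneg fun a _ => ?_)
    · split_ifs <;> positivity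
    · split_ifs
      · exact ih a _ _
      · exact uniformWeight_nonneg _
  | observation c ih => exact Finset.prod_nonneg fun a _ => ih a _ _

/-- Positive weight forces the secret to be the action of `ξ` at each point reached by `ξ`; the
remaining points do not affect the vector. -/
theorem vector_sharedStrategy [DecidableEq L] (t : DecisionTree L) (ξ : t.PureStrategy)
    (σ : Fin k → t.PureStrategy) (h : t.shareWeight ξ σ ≠ 0) :
    t.vector (t.sharedStrategy σ) = t.vector ξ := by
  induction t with
  | terminal z => rfl
  | decision c ih =>
    obtain ⟨h1, h2⟩ := mul_ne_zero_iff.1 h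
    have h1 : secret (fun j => (σ j).1) = ξ.1 := by
      by_contra hc
      exact h1 (if_neg hc)
    have h2 := Finset.prod_ne_zero_iff.1 h2 ξ.1 (Finset.mem_univ _)
    rw [if_pos rfl] at h2
    have := ih ξ.1 _ _ h2
    change (c (secret fun j => (σ j).1)).vector _ = (c ξ.1).vector (ξ.2 ξ.1)
    rw [← this]
    simp only [sharedStrategy]
    rw [h1]
  | observation c ih =>
    exact Finset.sum_congr rfl fun a _ =>
      ih a _ _ (Finset.prod_ne_zero_iff.1 h a (Finset.mem_univ _))

/-- The expectation of `f` under the shares of `ξ`. -/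
def shareMean (t : DecisionTree L) (f : (Fin k → t.PureStrategy) → ℝ) (ξ : t.PureStrategy) : ℝ :=
  ∑ σ, t.shareWeight ξ σ * f σ

/-- The expectation of `f` under uniform shares. -/
def uniformMean (t : DecisionTree L) (f : (Fin k → t.PureStrategy) → ℝ) : ℝ :=
  ∑ σ, uniformWeight k t * f σ

section Decision

variable {A : Type} [Fintype A] [Nonempty A] (c : A → DecisionTree L)

/-- The share assignments at a decision point, with their type unfolded. -/
def decisionEquiv :
    (Fin k → (decision c).PureStrategy) ≃ (Fin k → A × ((b : A) → (c b).PureStrategy)) :=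
  Equiv.refl _

/-- The share assignments at an observation point, with their type unfolded. -/
def observationEquiv :
    (Fin k → (observation c).PureStrategy) ≃ (Fin k → (b : A) → (c b).PureStrategy) :=
  Equiv.refl _

open Classical in
theorem shareMean_decision {F : (Fin k → (decision c).PureStrategy) → ℝ} (f : (Fin k → A) → ℝ)
    (g : (b : A) → (Fin k → (c b).PureStrategy) → ℝ)
    (hF : ∀ σ, F σ = f (fun j => (σ j).1) * ∏ b, g b fun j => (σ j).2 b)
    (a : A) (ξ : (b : A) → (c b).PureStrategy) :
    (decision c).shareMean F (a, ξ) =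
      ((Fintype.card A : ℝ) ^ k)⁻¹ *
        ((Fintype.card A : ℝ) * ∑ s, if secret s = a then f s else 0) *
      ∏ b, if b = a then (c b).shareMean (g b) (ξ b) else (c b).uniformMean (g b) := by
  have := sum_prod_pi_prod (ι := Fin k)
    (fun s => (if secret s = a then
      (Fintype.card A : ℝ) * ((Fintype.card A : ℝ) ^ k)⁻¹ else 0) * f s)
    (fun b τ => (if b = a then (c b).shareWeight (ξ b) τ else uniformWeight k (c b)) * g b τ)
  refine (Fintype.sum_equiv (decisionEquiv c) _ _
    fun σ => ?_).trans (this.trans ?_)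
  · exact (congrArg (_ * ·) (hF σ)).trans ((mul_mul_mul_comm _ _ _ _).trans
      (congrArg (_ * ·) Finset.prod_mul_distrib.symm))
  · congr 1
    · simp only [Finset.mul_sum]
      refine Finset.sum_congr rfl fun s _ => ?_
      split_ifs <;> ring
    · refine Finset.prod_congr rfl fun b _ => ?_
      split_ifs <;> rfl

theorem uniformMean_decision {F : (Fin k → (decision c).PureStrategy) → ℝ}
    (f : (Fin k → A) → ℝ) (g : (b : A) → (Fin k → (c b).PureStrategy) → ℝ)
    (hF : ∀ σ, F σ = f (fun j => (σ j).1) * ∏ b, g b fun j => (σ j).2 b) :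
    (decision c).uniformMean F =
      ((Fintype.card A : ℝ) ^ k)⁻¹ * (∑ s, f s) * ∏ b, (c b).uniformMean (g b) := by
  classical
  have := sum_prod_pi_prod (ι := Fin k)
    (fun s => ((Fintype.card A : ℝ) ^ k)⁻¹ * f s)
    (fun b τ => uniformWeight k (c b) * g b τ)
  refine (Fintype.sum_equiv (decisionEquiv c) _ _
    fun σ => ?_).trans (this.trans ?_)
  · exact (congrArg (_ * ·) (hF σ)).trans ((mul_mul_mul_comm _ _ _ _).trans
      (congrArg (_ * ·) Finset.prod_mul_distrib.symm))
  · simp only [Finset.mul_sum, uniformMean]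

theorem shareMean_observation {F : (Fin k → (observation c).PureStrategy) → ℝ}
    (g : (b : A) → (Fin k → (c b).PureStrategy) → ℝ)
    (hF : ∀ σ, F σ = ∏ b, g b fun j => σ j b) (ξ : (b : A) → (c b).PureStrategy) :
    (observation c).shareMean F ξ = ∏ b, (c b).shareMean (g b) (ξ b) := by
  classical
  have := sum_pi_prod (ι := Fin k) (fun b τ => (c b).shareWeight (ξ b) τ * g b τ)
  refine (Fintype.sum_equiv (observationEquiv c) _ _
    fun σ => ?_).trans this
  exact (congrArg (_ * ·) (hF σ)).trans Finset.prod_mul_distrib.symm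

theorem uniformMean_observation {F : (Fin k → (observation c).PureStrategy) → ℝ}
    (g : (b : A) → (Fin k → (c b).PureStrategy) → ℝ)
    (hF : ∀ σ, F σ = ∏ b, g b fun j => σ j b) :
    (observation c).uniformMean F = ∏ b, (c b).uniformMean (g b) := by
  classical
  have := sum_pi_prod (ι := Fin k) (fun b τ => uniformWeight k (c b) * g b τ)
  refine (Fintype.sum_equiv (observationEquiv c) _ _
    fun σ => ?_).trans this
  exact (congrArg (_ * ·) (hF σ)).trans Finset.prod_mul_distrib.symm

end Decision

/-- `g` is a product of functions of the actions at the single decision points. -/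
def Splits : (t : DecisionTree L) → (t.PureStrategy → ℝ) → Prop
  | terminal _, _ => True
  | @decision _ A _ _ c, g => ∃ (g₀ : A → ℝ) (g₁ : (b : A) → (c b).PureStrategy → ℝ),
      (∀ b, Splits (c b) (g₁ b)) ∧ ∀ ρ, g ρ = g₀ ρ.1 * ∏ b, g₁ b (ρ.2 b)
  | @observation _ A _ _ c, g => ∃ g₁ : (b : A) → (c b).PureStrategy → ℝ,
      (∀ b, Splits (c b) (g₁ b)) ∧ ∀ ρ, g ρ = ∏ b, g₁ b (ρ b)

theorem splits_one (t : DecisionTree L) : t.Splits fun _ => 1 := by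
  induction t with
  | terminal z => trivial
  | decision c ih => exact ⟨fun _ => 1, fun _ _ => 1, ih, by simp⟩
  | observation c ih => exact ⟨fun _ _ => 1, ih, by simp⟩

theorem Splits.mul {t : DecisionTree L} {f g : t.PureStrategy → ℝ} (hf : t.Splits f)
    (hg : t.Splits g) : t.Splits fun ρ => f ρ * g ρ := by
  induction t with
  | terminal z => trivial
  | decision c ih =>
    obtain ⟨f₀, f₁, hf₁, hf⟩ := hf
    obtain ⟨g₀, g₁, hg₁, hg⟩ := hg
    refine ⟨fun a => f₀ a * g₀ a, _, fun b => ih b (hf₁ b) (hg₁ b), fun ρ => ?_⟩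
    refine (congrArg₂ (· * ·) (hf ρ) (hg ρ)).trans ?_
    simp only [Finset.prod_mul_distrib]
    ring
  | observation c ih =>
    obtain ⟨f₁, hf₁, hf⟩ := hf
    obtain ⟨g₁, hg₁, hg⟩ := hg
    refine ⟨_, fun b => ih b (hf₁ b) (hg₁ b), fun ρ => ?_⟩
    refine (congrArg₂ (· * ·) (hf ρ) (hg ρ)).trans ?_
    simp only [Finset.prod_mul_distrib]

theorem Splits.prod {t : DecisionTree L} {ι : Type} (s : Finset ι) {f : ι → t.PureStrategy → ℝ}
    (hf : ∀ i, t.Splits (f i)) : t.Splits fun ρ => ∏ i ∈ s, f i ρ := by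
  classical
  induction s using Finset.induction_on with
  | empty => simpa using t.splits_one
  | insert i s hi ih => simpa [hi] using (hf i).mul ih

open Classical in
/-- The contribution of the child `b` to the reach indicator of a path. -/
def branchReach {A : Type} (c : A → DecisionTree L) (p : Σ b : A, (c b).SharePath) (b : A) :
    (c b).PureStrategy → ℝ :=
  Function.update (β := fun b => (c b).PureStrategy → ℝ) (fun _ _ => 1) p.1
    (fun ρ => reach (c p.1) ρ p.2) b

theorem branchReach_of_ne {A : Type} (c : A → DecisionTree L) (p : Σ b : A, (c b).SharePath)
    {b : A} (h : p.1 ≠ b) (ρ : (c b).PureStrategy) : branchReach c p b ρ = 1 := by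
  classical
  exact congrFun (Function.update_of_ne (β := fun b => (c b).PureStrategy → ℝ) h.symm
    (fun ρ => reach (c p.1) ρ p.2) fun _ _ => 1) ρ

theorem branchReach_self {A : Type} (c : A → DecisionTree L) (p : Σ b : A, (c b).SharePath)
    (ρ : (c p.1).PureStrategy) : branchReach c p p.1 ρ = reach (c p.1) ρ p.2 := by
  classical
  exact congrFun (Function.update_self (β := fun b => (c b).PureStrategy → ℝ) p.1
    (fun ρ => reach (c p.1) ρ p.2) fun _ _ => 1) ρ

theorem reach_eq_prod_branchReach {A : Type} [Fintype A] (c : A → DecisionTree L)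
    (p : Σ b : A, (c b).SharePath) (ρ : (b : A) → (c b).PureStrategy) :
    reach (c p.1) (ρ p.1) p.2 = ∏ b, branchReach c p b (ρ b) := by
  classical
  rw [Finset.prod_eq_single p.1 (fun b _ hb => branchReach_of_ne c p hb.symm _) (by simp),
    branchReach_self]

theorem splits_branchReach {A : Type} (c : A → DecisionTree L) (p : Σ b : A, (c b).SharePath)
    (h : (c p.1).Splits fun ρ => reach (c p.1) ρ p.2) (b : A) :
    (c b).Splits (branchReach c p b) := by
  rcases eq_or_ne p.1 b with rfl | hb
  · exact (funext (branchReach_self c p) : branchReach c p p.1 = _) ▸ h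
  · exact (funext (branchReach_of_ne c p hb) : branchReach c p b = _) ▸ splits_one _

theorem splits_reach (t : DecisionTree L) (q : t.SharePath) : t.Splits fun ρ => reach t ρ q := by
  classical
  induction t with
  | terminal z => trivial
  | decision c ih =>
    refine ⟨fun a => if q.1 = a then 1 else 0, branchReach c q.2, splits_branchReach c q.2 (ih _ _),
      fun ρ => ?_⟩
    exact congrArg (_ * ·) (reach_eq_prod_branchReach c q.2 ρ.2)
  | observation c ih =>
    exact ⟨branchReach c q, splits_branchReach c q (ih _ _), fun ρ => reach_eq_prod_branchReach c q ρ⟩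

/-- All but one of the shares carry no information. -/
theorem shareMean_eq_uniformMean (t : DecisionTree L) (j₀ : Fin k)
    (g : Fin k → t.PureStrategy → ℝ) (hg : ∀ j, t.Splits (g j)) (ξ : t.PureStrategy) :
    t.shareMean (fun σ => ∏ j ∈ Finset.univ.erase j₀, g j (σ j)) ξ =
      t.uniformMean fun σ => ∏ j ∈ Finset.univ.erase j₀, g j (σ j) := by
  classical
  induction t with
  | terminal z => rfl
  | decision c ih =>
    choose g₀ g₁ hg₁ h using hg
    have e (σ : Fin k → (decision c).PureStrategy) : ∏ j ∈ Finset.univ.erase j₀, g j (σ j) =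
        (∏ j ∈ Finset.univ.erase j₀, g₀ j (σ j).1) *
          ∏ b, ∏ j ∈ Finset.univ.erase j₀, g₁ j b ((σ j).2 b) := by
      rw [Finset.prod_comm, ← Finset.prod_mul_distrib]
      exact Finset.prod_congr rfl fun j _ => h j (σ j)
    obtain ⟨a, ξ⟩ := ξ
    refine (shareMean_decision c (fun s => ∏ j ∈ Finset.univ.erase j₀, g₀ j (s j))
      (fun b τ => ∏ j ∈ Finset.univ.erase j₀, g₁ j b (τ j)) e a ξ).trans
      (Eq.trans ?_ (uniformMean_decision c (fun s => ∏ j ∈ Finset.univ.erase j₀, g₀ j (s j))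
      (fun b τ => ∏ j ∈ Finset.univ.erase j₀, g₁ j b (τ j)) e).symm)
    -- The root factor does not involve share `j₀`, so conditioning on the secret has no effect on
    -- it.
    rw [sum_secret_eq j₀]
    · congr 1
      refine Finset.prod_congr rfl fun b _ => ?_
      split_ifs
      · exact ih b _ (fun j => hg₁ j b) _
      · rfl
    · intro s b
      refine Finset.prod_congr rfl fun j hj => ?_
      rw [Function.update_of_ne (Finset.ne_of_mem_erase hj)]
  | observation c ih =>
    choose g₁ hg₁ h using hg
    have e (σ : Fin k → (observation c).PureStrategy) : ∏ j ∈ Finset.univ.erase j₀, g j (σ j) =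
        ∏ b, ∏ j ∈ Finset.univ.erase j₀, g₁ j b (σ j b) := by
      rw [Finset.prod_comm]
      exact Finset.prod_congr rfl fun j _ => h j (σ j)
    refine (shareMean_observation c (fun b τ => ∏ j ∈ Finset.univ.erase j₀, g₁ j b (τ j))
      e ξ).trans (Eq.trans ?_ (uniformMean_observation c
      (fun b τ => ∏ j ∈ Finset.univ.erase j₀, g₁ j b (τ j)) e).symm)
    exact Finset.prod_congr rfl fun b _ => ih b _ (fun j => hg₁ j b) _

theorem uniformMean_one (t : DecisionTree L) :
    t.uniformMean (fun _ : Fin k → t.PureStrategy => 1) = 1 := by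
  induction t with
  | terminal z =>
    have : Unique (terminal z).PureStrategy := inferInstanceAs (Unique Unit)
    simp [uniformMean, uniformWeight]
  | @decision A _ _ c ih =>
    classical
    rw [uniformMean_decision c (fun _ => 1) (fun _ _ => 1) (by simp)]
    simp [ih]
  | observation c ih =>
    rw [uniformMean_observation c (fun _ _ => 1) (by simp)]
    simp [ih]

/-- The constant 1 reads no share at all, so its mean is the uniform one. At least one share is
needed: for `k = 0` the secret is a fixed element. -/
theorem sum_shareWeight [NeZero k] (t : DecisionTree L) (ξ : t.PureStrategy) :
    ∑ σ : Fin k → t.PureStrategy, t.shareWeight ξ σ = 1 := by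
  have := t.shareMean_eq_uniformMean (0 : Fin k) (fun _ _ => 1) (fun _ => t.splits_one) ξ
  simpa [uniformMean_one, shareMean] using this

section

variable [Fintype L] [DecidableEq L]

theorem linearInVector_shareMean_of_missing {t : DecisionTree L}
    (ht : ∀ z, t.leafCount z ≤ 1) (j₀ : Fin k) (g : Fin k → t.PureStrategy → ℝ)
    (hg : ∀ j, t.Splits (g j)) (h₀ : ∀ ρ, g j₀ ρ = 1) :
    t.LinearInVector (t.shareMean fun σ => ∏ j, g j (σ j)) := by
  have : t.shareMean (fun σ => ∏ j, g j (σ j)) = fun _ =>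
      t.uniformMean fun σ => ∏ j ∈ Finset.univ.erase j₀, g j (σ j) := by
    ext1 ξ
    rw [← shareMean_eq_uniformMean t j₀ g hg ξ]
    congr 1
    ext1 σ
    rw [← Finset.mul_prod_erase _ _ (Finset.mem_univ j₀), h₀, one_mul]
  rw [this]
  exact linearInVector_const ht _

/-- If all paths enter the child `a`, this is the induction hypothesis; if one leaves, its share is
not read below `a` and the mean is constant. -/
theorem linearInVector_branch {A : Type} (c : A → DecisionTree L) (a : A)
    (ha : ∀ z, (c a).leafCount z ≤ 1)
    (ih : ∀ w : Fin k → (c a).SharePath,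
      (c a).LinearInVector ((c a).shareMean fun σ => ∏ j, reach (c a) (σ j) (w j)))
    (p : Fin k → Σ b : A, (c b).SharePath) :
    (c a).LinearInVector ((c a).shareMean fun σ => ∏ j, branchReach c (p j) a (σ j)) := by
  by_cases h : ∀ j, (p j).1 = a
  · have : ∀ j, ∃ q : (c a).SharePath, p j = ⟨a, q⟩ := fun j => by
      obtain ⟨b, q⟩ := p j |>.1, (p j).2
      have := h j
      revert this
      cases p j
      rintro rfl
      exact ⟨_, rfl⟩
    choose q hq using this
    convert ih q using 6 with σ j
    rw [hq]
    exact branchReach_self c ⟨a, q _⟩ _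
  · push Not at h
    obtain ⟨j₀, hj⟩ := h
    exact linearInVector_shareMean_of_missing ha j₀ _ (fun j => splits_branchReach c (p j) (splits_reach _ _) a)
      (branchReach_of_ne c _ hj)

/-- The mean of a query that reads every share once is linear in the vector of the strategy. -/
theorem linearInVector_shareMean_reach [NeZero k] {t : DecisionTree L}
    (ht : ∀ z, t.leafCount z ≤ 1) (w : Fin k → t.SharePath) :
    t.LinearInVector (t.shareMean fun σ => ∏ j, reach t (σ j) (w j)) := by
  classical
  induction t with
  | terminal z =>
    exact ⟨fun _ => (terminal z).shareMean (fun σ => ∏ j, reach _ (σ j) (w j)) (),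
      fun ξ => by simp [vector, Pi.single_apply]; rfl⟩
  | @decision A _ _ c ih =>
    have hc : ∀ a z, (c a).leafCount z ≤ 1 := fun a z =>
      (leafCount_decision_child_le a).trans (ht z)
    have e (σ : Fin k → (decision c).PureStrategy) : ∏ j, reach (decision c) (σ j) (w j) =
        (∏ j, if (w j).1 = (σ j).1 then (1 : ℝ) else 0) *
          ∏ b, ∏ j, branchReach c (w j).2 b ((σ j).2 b) := by
      rw [Finset.prod_comm, ← Finset.prod_mul_distrib]
      exact Finset.prod_congr rfl fun j _ =>
        congrArg (_ * ·) (reach_eq_prod_branchReach c (w j).2 (σ j).2)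
    -- If `ξ` plays `a`, the shares below the other children are uniform. Hence only the factor of
    -- the child `a` depends on the rest of `ξ`; everything else is a coefficient determined by `a`.
    have h := LinearInVector.decision ht fun a =>
      (linearInVector_branch c a (hc a) (ih a (hc a)) fun j => (w j).2).const_mul
        (((Fintype.card A : ℝ) ^ k)⁻¹ * ((Fintype.card A : ℝ) * ∑ s : Fin k → A,
            if secret s = a then ∏ j, if (w j).1 = s j then (1 : ℝ) else 0 else 0) *
          ∏ b ∈ Finset.univ.erase a,
            (c b).uniformMean fun τ : Fin k → _ => ∏ j, branchReach c (w j).2 b (τ j))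
    convert h using 1
    ext1 ξ
    obtain ⟨a, ξ⟩ := ξ
    refine (shareMean_decision c (fun s => ∏ j, if (w j).1 = s j then (1 : ℝ) else 0)
      (fun b τ => ∏ j, branchReach c (w j).2 b (τ j)) e a ξ).trans ?_
    rw [← Finset.mul_prod_erase _ _ (Finset.mem_univ a), if_pos rfl]
    rw [Finset.prod_congr rfl fun b hb => if_neg (Finset.ne_of_mem_erase hb)]
    dsimp only
    ring
  | @observation A _ _ c ih =>
    have hc : ∀ a z, (c a).leafCount z ≤ 1 := fun a z =>
      (leafCount_observation_child_le a).trans (ht z)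
    have e (σ : Fin k → (observation c).PureStrategy) : ∏ j, reach (observation c) (σ j) (w j) =
        ∏ b, ∏ j, branchReach c (w j) b (σ j b) := by
      rw [Finset.prod_comm]
      exact Finset.prod_congr rfl fun j _ => reach_eq_prod_branchReach c (w j) (σ j)
    -- Share 0 is read below the single child `(w 0).1`, so the factors of all other children are
    -- constants. The product over the children thus has one nonconstant factor at most, and stays
    -- linear.
    have h := (LinearInVector.observation ht (w 0).1
      (linearInVector_branch c _ (hc _) (ih _ (hc _)) w)).const_mul
        (∏ b ∈ Finset.univ.erase (w 0).1,
            (c b).uniformMean fun τ : Fin k → _ =>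
              ∏ j ∈ Finset.univ.erase 0, branchReach c (w j) b (τ j))
    convert h using 1
    ext1 ξ
    refine (shareMean_observation c (fun b τ => ∏ j, branchReach c (w j) b (τ j)) e ξ).trans ?_
    rw [← Finset.mul_prod_erase _ _ (Finset.mem_univ (w 0).1), mul_comm]
    congr 1
    refine Finset.prod_congr rfl fun b hb => ?_
    rw [← shareMean_eq_uniformMean _ 0 _ (fun j => splits_branchReach c (w j) (splits_reach _ _) b) (ξ b)]
    congr 1
    ext1 σ
    rw [← Finset.mul_prod_erase _ _ (Finset.mem_univ (0 : Fin k)),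
      branchReach_of_ne c _ (Finset.ne_of_mem_erase hb).symm, one_mul]

/-- The mean of any `k` queries is linear in the vector of the strategy. -/
theorem linearInVector_shareMean_queries [NeZero k] {t : DecisionTree L}
    (ht : ∀ z, t.leafCount z ≤ 1) (w : Fin k → Fin k × t.SharePath) :
    t.LinearInVector (t.shareMean fun σ => ∏ l, reach t (σ (w l).1) (w l).2) := by
  -- There are as many queries as shares: either each share is read exactly once, or some share is
  -- never read.
  by_cases hs : Function.Surjective fun l => (w l).1
  · let e := Equiv.ofBijective _ ⟨Finite.injective_iff_surjective.2 hs, hs⟩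
    convert linearInVector_shareMean_reach ht fun j => (w (e.symm j)).2 using 2
    ext1 σ
    exact Fintype.prod_equiv e _ _ fun l => by simp only [Equiv.symm_apply_apply]; rfl
  · simp only [Function.Surjective, not_forall, not_exists] at hs
    obtain ⟨j₀, hj⟩ := hs
    have := linearInVector_shareMean_of_missing ht j₀
      (fun j ρ => ∏ l ∈ Finset.univ.filter fun l => (w l).1 = j, reach t ρ (w l).2)
      (fun j => Splits.prod _ fun l => splits_reach t (w l).2) (by simp [hj])
    convert this using 2
    ext1 σ
    rw [← Finset.prod_fiberwise _ (fun l => (w l).1)]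
    refine Finset.prod_congr rfl fun j _ => Finset.prod_congr rfl fun l hl => ?_
    rw [(Finset.mem_filter.1 hl).2]

end

end Weights

end DecisionTree

end TreeForm

end

/-! ### Expectations over finite distributions -/

noncomputable section

namespace TreeForm

section Expectation

variable {Ω Ω' V : Type} [Fintype Ω] [Fintype Ω'] [AddCommGroup V] [Module ℝ V]

theorem expect_congr {p : PMF Ω} {f g : Ω → V} (h : ∀ ω, p ω ≠ 0 → f ω = g ω) :
    expect p f = expect p g := by
  refine Finset.sum_congr rfl fun ω _ => ?_
  by_cases h0 : p ω = 0
  · simp [h0]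
  · rw [h ω h0]

theorem expect_bind (p : PMF Ω) (q : Ω → PMF Ω') (f : Ω' → V) :
    expect (p.bind q) f = expect p fun ω => expect (q ω) f := by
  have h : ∀ b, ((p.bind q) b).toReal = ∑ a, (p a).toReal * (q a b).toReal := by
    intro b
    rw [PMF.bind_apply, tsum_fintype, ENNReal.toReal_sum fun a _ =>
      ENNReal.mul_ne_top (p.apply_ne_top a) ((q a).apply_ne_top b)]
    simp only [ENNReal.toReal_mul]
  simp only [expect, h, Finset.sum_smul, Finset.smul_sum, mul_smul]
  exact Finset.sum_comm

theorem expect_pure (ω : Ω) (f : Ω → V) : expect (PMF.pure ω) f = f ω := by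
  classical
  rw [expect, Finset.sum_eq_single ω]
  · simp
  · intro b _ hb
    simp [PMF.pure_apply, hb]
  · simp

theorem expect_map (p : PMF Ω) (g : Ω → Ω') (f : Ω' → V) :
    expect (p.map g) f = expect p fun ω => f (g ω) := by
  rw [PMF.map, expect_bind]
  simp only [Function.comp_apply, expect_pure]

theorem sum_toReal (p : PMF Ω) : ∑ ω, (p ω).toReal = 1 := by
  rw [← ENNReal.toReal_sum fun a _ => p.apply_ne_top a, ← tsum_fintype (L := .unconditional Ω),
    p.tsum_coe, ENNReal.toReal_one]

theorem expect_const (p : PMF Ω) (v : V) : expect p (fun _ => v) = v := by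
  rw [expect, ← Finset.sum_smul, sum_toReal, one_smul]

theorem expect_mem_of_convex (p : PMF Ω) {f : Ω → V} {s : Set V} (hs : Convex ℝ s)
    (hf : ∀ ω, f ω ∈ s) : expect p f ∈ s :=
  hs.sum_mem (fun _ _ => ENNReal.toReal_nonneg) (sum_toReal p) fun ω _ => hf ω

theorem map_eq_pure {α β : Type*} {p : PMF α} {f : α → β} {b : β} (h : ∀ a, p a ≠ 0 → f a = b) :
    p.map f = PMF.pure b := by
  classical
  rw [← PMF.map_const p b]
  ext c
  simp only [PMF.map_apply]
  refine tsum_congr fun a => ?_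
  by_cases h0 : p a = 0
  · simp [h0]
  · rw [h a h0]; rfl

theorem map_productPMF {n : ℕ} {Ω : Fin n → Type} [∀ i, Fintype (Ω i)]
    (p : (i : Fin n) → PMF (Ω i)) (i : Fin n) : (productPMF p).map (fun ω => ω i) = p i := by
  classical
  ext b
  rw [PMF.map_apply, tsum_fintype]
  let h : (j : Fin n) → Ω j → ENNReal :=
    Function.update (fun j a => p j a) i fun a => if b = a then p i a else 0
  have hne : ∀ j ≠ i, h j = fun a => p j a := fun j hj => Function.update_of_ne hj _ _
  have hi : h i = fun a => if b = a then p i a else 0 := Function.update_self _ _ _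
  have e : ∀ ω : (j : Fin n) → Ω j,
      (if b = ω i then productPMF p ω else 0) = ∏ j, h j (ω j) := by
    intro ω
    have : ∏ j ∈ Finset.univ.erase i, h j (ω j) = ∏ j ∈ Finset.univ.erase i, p j (ω j) :=
      Finset.prod_congr rfl fun j hj => by rw [hne j (Finset.ne_of_mem_erase hj)]
    rw [← Finset.mul_prod_erase _ _ (Finset.mem_univ i), this, hi, productPMF,
      PMF.ofFintype_apply, ← Finset.mul_prod_erase _ _ (Finset.mem_univ i)]
    by_cases hb : b = ω i <;> simp [hb]
  simp only [e]
  rw [← Fintype.prod_sum, Finset.prod_eq_single i]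
  · simp [hi]
  · intro j _ hj
    rw [hne j hj, ← tsum_fintype (L := .unconditional (Ω j)), (p j).tsum_coe]
  · simp

theorem expect_productPMF {n : ℕ} {Ω : Fin n → Type} [∀ i, Fintype (Ω i)]
    (p : (i : Fin n) → PMF (Ω i)) (i : Fin n) (f : Ω i → V) :
    expect (productPMF p) (fun ω => f (ω i)) = expect (p i) f := by
  conv_rhs => rw [← map_productPMF p i, expect_map]

theorem productPMF_ne_zero {n : ℕ} {Ω : Fin n → Type} [∀ i, Fintype (Ω i)]
    {p : (i : Fin n) → PMF (Ω i)} {ω : (i : Fin n) → Ω i} (h : productPMF p ω ≠ 0) (i : Fin n) :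
    p i (ω i) ≠ 0 := by
  rw [productPMF, PMF.ofFintype_apply] at h
  exact Finset.prod_ne_zero_iff.1 h i (Finset.mem_univ i)

end Expectation

/-! ### The signal problem and averaging over signals -/

namespace DecisionProblem

open DecisionTree

variable (k : ℕ) [NeZero k] (X : DecisionProblem)

/-- The decision problem in which a strategy of `X` is announced by `k` separate shares. -/
def shareProblem : DecisionProblem where
  Z := Fin k × X.tree.SharePath
  tree := observation fun j : Fin k => shareTree X.tree fun q => (j, q)
  leafCount_eq_one := fun z => by
    simp only [leafCount, leafCount_shareTree]
    rw [← Fintype.sum_prod_type']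
    simp

variable {k X}

/-- The vector of a share assignment. -/
def shareVector (σ : Fin k → X.tree.PureStrategy) (w : Fin k × X.tree.SharePath) : ℝ :=
  X.tree.reach (σ w.1) w.2

theorem mem_pureVectors_shareProblem {y : Fin k × X.tree.SharePath → ℝ} :
    y ∈ (shareProblem k X).tree.pureVectors ↔ ∃ σ, y = shareVector σ := by
  have aux (ρ : Fin k → X.tree.PureStrategy) (w : Fin k × X.tree.SharePath) :
      ∑ j, ∑ q, (if (j, q) = w then X.tree.reach (ρ j) q else 0) = shareVector ρ w := by
    rw [← Fintype.sum_prod_type' (f := fun j q =>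
      if (j, q) = w then X.tree.reach (ρ j) q else 0)]
    simp [shareVector]
  constructor
  · rintro ⟨σ, rfl⟩
    choose ρ hρ using fun j => exists_vector_shareTree X.tree (fun q => (j, q)) (σ j)
    refine ⟨ρ, funext fun w => (Finset.sum_apply w _ _).trans ?_⟩
    exact (Finset.sum_congr rfl fun j _ => hρ j w).trans (aux ρ w)
  · rintro ⟨ρ, rfl⟩
    choose σ hσ using fun j => exists_strategy_shareTree X.tree (fun q => (j, q)) (ρ j)
    refine ⟨σ, funext fun w => (Finset.sum_apply w _ _).trans ?_⟩
    exact (Finset.sum_congr rfl fun j _ => hσ j w).trans (aux ρ w)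

/-- The pure strategy of `shareProblem k X` for a share assignment. -/
def signal (σ : Fin k → X.tree.PureStrategy) : (shareProblem k X).Pure :=
  ⟨shareVector σ, mem_pureVectors_shareProblem.2 ⟨σ, rfl⟩⟩

variable (k X) in
theorem exists_mediator_strategy :
    ∃ q ∈ (X.tree.interleave
        (interleaveFamily fun _ : Fin k => (shareProblem k X).tree.dual)).mixedVectors,
      ∀ (σ : Fin k → X.tree.PureStrategy) (z : X.Z),
        ∑ w : Fin k → (shareProblem k X).Z, q (z, w) * ∏ l, shareVector σ (w l) =
          X.tree.vector (X.tree.sharedStrategy σ) z := by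
  obtain ⟨q, hq, h⟩ := achieves_sharedStrategy (η := fun σ => shareVector σ) X.tree
    (fun (l : Fin k) q => (l, q)) (fun _ _ => 1) (fun σ => σ)
    (fun σ l q => (one_mul _).symm) (fun _ => (shareProblem k X).tree.dual)
    (fun l => Relation.ReflTransGen.single
      (Move.mk (fun j => (shareTree X.tree fun q => (j, q)).dual) l))
  refine ⟨q, subset_convexHull ℝ _ hq, fun σ z => (h σ z).trans ?_⟩
  simp

/-- The strategy of `X` that is recovered from its shares. -/
def recover (y : (shareProblem k X).Pure) : X.Mixed :=
  ⟨X.tree.vector (X.tree.sharedStrategy (mem_pureVectors_shareProblem.1 y.2).choose),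
    subset_convexHull ℝ _ ⟨_, rfl⟩⟩

theorem recover_eq (y : (shareProblem k X).Pure) : ∃ σ, y.1 = shareVector σ ∧
    (recover y : X.Z → ℝ) = X.tree.vector (X.tree.sharedStrategy σ) :=
  ⟨_, (mem_pureVectors_shareProblem.1 y.2).choose_spec, rfl⟩

theorem recover_mem_mediatorDeviations :
    (recover : (shareProblem k X).Pure → X.Mixed) ∈ mediatorDeviations k X (shareProblem k X) := by
  obtain ⟨q, hq, h⟩ := exists_mediator_strategy k X
  refine ⟨q, hq, fun y z => ?_⟩
  obtain ⟨σ, h1, h2⟩ := recover_eq y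
  rw [h2, ← h σ z, ← h1]

/-- A signal need not determine its share assignment. The recovered vector is nevertheless well
defined, since the mediator formula expresses it through the signal alone. -/
theorem recover_signal (σ : Fin k → X.tree.PureStrategy) :
    (recover (signal σ) : X.Z → ℝ) = X.tree.vector (X.tree.sharedStrategy σ) := by
  obtain ⟨q, -, h⟩ := exists_mediator_strategy k X
  obtain ⟨τ, h1, h2⟩ := recover_eq (signal σ)
  rw [h2]
  ext z
  have h1 : shareVector σ = shareVector τ := h1
  rw [← h, ← h, h1]

/-- A pure strategy with a given vector. -/
def someStrategy (x : X.Pure) : X.tree.PureStrategy := x.2.choose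

theorem vector_someStrategy (x : X.Pure) : X.tree.vector (someStrategy x) = x.1 :=
  x.2.choose_spec

variable (k) in
/-- The random shares of a strategy. -/
def sharePMF (x : X.Pure) : PMF (Fin k → X.tree.PureStrategy) :=
  PMF.ofFintype (fun σ => ENNReal.ofReal (X.tree.shareWeight (someStrategy x) σ)) (by
    rw [← ENNReal.ofReal_sum_of_nonneg fun σ _ => shareWeight_nonneg _ _ σ, sum_shareWeight,
      ENNReal.ofReal_one])

variable (k) in
/-- The random signal that shares a strategy. -/
def signalPMF (x : X.Pure) : PMF (shareProblem k X).Pure :=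
  (sharePMF k x).map signal

theorem recover_of_signalPMF_ne_zero {x : X.Pure} {y : (shareProblem k X).Pure}
    (h : signalPMF k x y ≠ 0) : recover y = X.incl x := by
  obtain ⟨σ, hσ, rfl⟩ := (PMF.mem_support_map_iff _ _ _).1 ((PMF.mem_support_iff _ _).2 h)
  refine Subtype.ext ?_
  rw [recover_signal, vector_sharedStrategy X.tree (someStrategy x), vector_someStrategy]
  · rfl
  · intro h0
    refine (PMF.mem_support_iff _ _).1 hσ ?_
    rw [sharePMF, PMF.ofFintype_apply, h0, ENNReal.ofReal_zero]

/-- The mean of a mediator deviation over the signals for a strategy. -/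
def meanDeviation (φ : (shareProblem k X).Pure → X.Mixed) (x : X.Pure) : X.Mixed :=
  ⟨expect (signalPMF k x) fun y => (φ y : X.Z → ℝ),
    expect_mem_of_convex _ (convex_convexHull ℝ _) fun y => (φ y).2⟩

/-- The mediator formula is a combination of products of `k` coordinates of the signal; averaged
over the shares, each such product is linear in the strategy vector. -/
theorem meanDeviation_mem_linearDeviations {φ : (shareProblem k X).Pure → X.Mixed}
    (hφ : φ ∈ mediatorDeviations k X (shareProblem k X)) :
    meanDeviation φ ∈ linearDeviations X X := by
  obtain ⟨q, -, hq⟩ := hφ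
  choose g hg using fun w => linearInVector_shareMean_queries (k := k) (t := X.tree)
    (fun z => (X.leafCount_eq_one z).le) w
  refine ⟨Matrix.mulVecLin (Matrix.of fun z z' => ∑ w, q (z, w) * g w z'), fun x => ?_⟩
  ext z
  have h1 : (meanDeviation φ x : X.Z → ℝ) z =
      ∑ σ, X.tree.shareWeight (someStrategy x) σ *
        ∑ w, q (z, w) * ∏ l, X.tree.reach (σ (w l).1) (w l).2 := by
    change expect (signalPMF k x) (fun y => (φ y : X.Z → ℝ)) z = _
    rw [signalPMF, expect_map, expect, Finset.sum_apply]
    refine Finset.sum_congr rfl fun σ _ => ?_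
    rw [sharePMF, PMF.ofFintype_apply, ENNReal.toReal_ofReal (shareWeight_nonneg _ _ _),
      Pi.smul_apply, hq, smul_eq_mul]
    rfl
  have h2 : ∀ w, ∑ σ, X.tree.shareWeight (someStrategy x) σ *
      ∏ l, X.tree.reach (σ (w l).1) (w l).2 = ∑ z, g w z * x.1 z := by
    intro w
    rw [← vector_someStrategy, ← hg w (someStrategy x)]
    rfl
  rw [h1]
  simp only [Finset.mul_sum, mul_left_comm _ (q _)]
  rw [Finset.sum_comm]
  simp only [Matrix.mulVecLin_apply, Matrix.mulVec, dotProduct, Matrix.of_apply, Finset.sum_mul,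
    mul_assoc]
  rw [Finset.sum_comm (s := Finset.univ (α := X.Z))]
  refine Finset.sum_congr rfl fun w _ => ?_
  rw [← Finset.mul_sum, ← Finset.mul_sum]
  exact congrArg _ (h2 w)

end DecisionProblem

/-! ### Transfer of equilibria to the shared profile -/

namespace Game

variable {n : ℕ} {G : Game n}

theorem utility_update (i : Fin n) (x : (j : Fin n) → (G.X j).Mixed) (m : (G.X i).Mixed) :
    G.utility i (Function.update x i m) =
      G.u i (Function.update (fun j => (x j : (G.X j).Z → ℝ)) i m) := by
  rw [utility]
  congr 1
  ext1 j
  rcases eq_or_ne j i with rfl | hj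
  · simp
  · simp [hj]

theorem expect_utility_update {Ω : Type} [Fintype Ω] (p : PMF Ω) (i : Fin n)
    (x : (j : Fin n) → (G.X j).Mixed) (f : Ω → (G.X i).Mixed) (m : (G.X i).Mixed)
    (hm : (m : (G.X i).Z → ℝ) = expect p fun ω => (f ω : (G.X i).Z → ℝ)) :
    expect p (fun ω => G.utility i (Function.update x i (f ω))) =
      G.utility i (Function.update x i m) := by
  simp only [utility_update, hm, expect]
  rw [MultilinearMap.map_update_sum]
  simp only [MultilinearMap.map_update_smul]

/-- The generalized profile in which the strategies of a correlated profile are announced by `k`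
separate shares. -/
def sharedProfile (k : ℕ) [NeZero k] (π : G.CorrelatedProfile) : G.GeneralizedProfile where
  Y := fun i => (G.X i).shareProblem k
  φ := fun _ => DecisionProblem.recover
  π := π.bind fun x => productPMF fun i => DecisionProblem.signalPMF k (x i)

variable {k : ℕ} [NeZero k] (π : G.CorrelatedProfile)

theorem sharedProfile_play {x : (i : Fin n) → (G.X i).Pure}
    {y : (i : Fin n) → ((G.X i).shareProblem k).Pure}
    (h : productPMF (fun i => DecisionProblem.signalPMF k (x i)) y ≠ 0) :
    (sharedProfile k π).play y = fun i => (G.X i).incl (x i) :=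
  funext fun i => DecisionProblem.recover_of_signalPMF_ne_zero (productPMF_ne_zero h i)

theorem sharedProfile_equivalent :
    (sharedProfile k π).Equivalent (GeneralizedProfile.canonical π) := by
  change PMF.map _ (π.bind _) = PMF.map _ π
  refine (PMF.map_bind _ _ _).trans (Eq.trans ?_ (PMF.bind_pure_comp _ _))
  refine congrArg _ (funext fun x => ?_)
  exact map_eq_pure fun y hy => sharedProfile_play π hy

/-- Given the recommendations `x`, the opponents almost surely play `x` and the deviator's signal
consists of independently drawn shares of `x i`. By multilinearity the deviation can be replaced by
its mean over the signal, which is a linear deviation. -/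
theorem sharedProfile_isEquilibrium {ε : ℝ} (h : G.IsEquilibrium linearDeviations ε π) :
    (sharedProfile k π).IsEquilibrium (mediatorDeviations k) ε := by
  refine ⟨fun i => DecisionProblem.recover_mem_mediatorDeviations, fun i φ hφ => ?_⟩
  have h1 : expect (sharedProfile k π).π (fun y => G.utility i
      (Function.update ((sharedProfile k π).play y) i (φ (y i)))) =
      expect π fun x => G.utility i (Function.update (fun j => (G.X j).incl (x j)) i
        (DecisionProblem.meanDeviation φ (x i))) := by
    refine (expect_bind _ _ _).trans (congrArg _ (funext fun x => ?_))
    refine (expect_congr (g := fun y : (j : Fin n) → ((G.X j).shareProblem k).Pure => G.utility i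
      (Function.update (fun j => (G.X j).incl (x j)) i (φ (y i)))) fun y hy => ?_).trans ?_
    · rw [sharedProfile_play π hy]
    · refine (expect_productPMF (fun j => DecisionProblem.signalPMF k (x j)) i
        fun y : ((G.X i).shareProblem k).Pure => G.utility i
        (Function.update (fun j => (G.X j).incl (x j)) i (φ y))).trans ?_
      exact expect_utility_update _ i _ _ _ rfl
  have h2 : expect (sharedProfile k π).π (fun y => G.utility i ((sharedProfile k π).play y)) =
      expect π fun x => G.utility i fun j => (G.X j).incl (x j) := by
    refine (expect_bind _ _ _).trans (congrArg _ (funext fun x => ?_))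
    refine (expect_congr fun y hy => ?_).trans (expect_const _ _)
    rw [sharedProfile_play π hy]
  rw [h1, h2]
  exact h i _ (DecisionProblem.meanDeviation_mem_linearDeviations hφ)

end Game

end TreeForm

end

/-! ### Consistent strategy maps at pure strategies -/

noncomputable section

namespace TreeForm

open DecisionTree

theorem eq_pure_of_forall {α : Type*} {p : PMF α} {b : α} (h : ∀ a, p a ≠ 0 → a = b) :
    p = PMF.pure b := by
  rw [← map_eq_pure (f := id) h, PMF.map_id]

theorem productPMF_pure {n : ℕ} {Ω : Fin n → Type} [∀ i, Fintype (Ω i)] (x : (i : Fin n) → Ω i) :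
    productPMF (fun i => PMF.pure (x i)) = PMF.pure x :=
  eq_pure_of_forall fun ω h => funext fun i => by
    classical
    by_contra hne
    exact productPMF_ne_zero h i (by simp [PMF.pure_apply, hne])

namespace DecisionProblem

variable {X : DecisionProblem}

theorem sq_apply_eq (x : X.Pure) (z : X.Z) : (x : X.Z → ℝ) z ^ 2 = (x : X.Z → ℝ) z := by
  obtain ⟨_, σ, rfl⟩ := x
  obtain ⟨n, h1, h2⟩ := X.tree.exists_vector_eq_natCast σ z
  rw [X.leafCount_eq_one] at h2
  change X.tree.vector σ z ^ 2 = X.tree.vector σ z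
  rw [h1]
  interval_cases n <;> norm_num

end DecisionProblem

/-- Pure strategies are vertices of a cube: a distribution on `0/1` vectors whose mean is such a
vector has zero variance in each coordinate. -/
theorem StrategyMap.Consistent.apply_incl {δ : StrategyMap} (hδ : δ.Consistent)
    (X : DecisionProblem) (x : X.Pure) : δ X (X.incl x) = PMF.pure x := by
  refine eq_pure_of_forall fun x' hx' => Subtype.ext (funext fun z => ?_)
  have h1 : ∑ y, (δ X (X.incl x) y).toReal * (y : X.Z → ℝ) z = (x : X.Z → ℝ) z := by
    have := congrFun (hδ X (X.incl x)) z
    rw [expect, Finset.sum_apply] at this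
    exact this
  have h2 : ∑ y, (δ X (X.incl x) y).toReal * ((y : X.Z → ℝ) z - (x : X.Z → ℝ) z) ^ 2 = 0 := by
    have e : ∀ y : X.Pure, (δ X (X.incl x) y).toReal * ((y : X.Z → ℝ) z - (x : X.Z → ℝ) z) ^ 2 =
        (δ X (X.incl x) y).toReal * (y : X.Z → ℝ) z * (1 - 2 * (x : X.Z → ℝ) z) +
          (δ X (X.incl x) y).toReal * (x : X.Z → ℝ) z := by
      intro y
      rw [sub_sq, X.sq_apply_eq, X.sq_apply_eq]
      ring
    simp only [e, Finset.sum_add_distrib, ← Finset.sum_mul, h1, sum_toReal]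
    linear_combination (-2) * X.sq_apply_eq x z
  have h3 := (Finset.sum_eq_zero_iff_of_nonneg fun y _ => by positivity).1 h2 x'
    (Finset.mem_univ _)
  rcases mul_eq_zero.1 h3 with h | h
  · exact absurd ((ENNReal.toReal_eq_zero_iff _).1 h)
      (not_or.2 ⟨hx', (δ X (X.incl x)).apply_ne_top x'⟩)
  · exact sub_eq_zero.1 (pow_eq_zero_iff two_ne_zero |>.1 h)

theorem Game.GeneralizedProfile.induced_of_equivalent_canonical {n : ℕ} {G : Game n}
    {δ : StrategyMap} (hδ : δ.Consistent) {P : G.GeneralizedProfile} {π : G.CorrelatedProfile}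
    (h : P.Equivalent (canonical π)) : P.induced δ = π := by
  rw [induced, show P.outcome = _ from h]
  refine (PMF.bind_map _ _ _).trans (Eq.trans (congrArg _ (funext fun x => ?_)) π.bind_pure)
  refine (congrArg productPMF (funext fun i => ?_)).trans (productPMF_pure x)
  exact hδ.apply_incl _ _

/-! ### The parity counterexample -/

section Parity

/-- The environment chooses one of two decision points, each with two actions. -/
def bitsTree : DecisionTree (Bool × Bool) :=
  observation fun a : Bool => decision fun b : Bool => terminal (a, b)

/-- The decision problem of choosing two bits, one of which is asked for. -/
def bits : DecisionProblem where
  Z := Bool × Bool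
  tree := bitsTree
  leafCount_eq_one := by
    rintro ⟨_ | _, _ | _⟩ <;> simp only [bitsTree, leafCount, Fintype.sum_bool] <;> rfl

/-- The vector of the strategy that plays `h a` at the decision point `a`. -/
def bitsVector (h : Bool → Bool) (z : Bool × Bool) : ℝ := if z.2 = h z.1 then 1 else 0

theorem mem_pureVectors_bitsTree {y : Bool × Bool → ℝ} :
    y ∈ bitsTree.pureVectors ↔ ∃ h, y = bitsVector h := by
  have aux (σ : bitsTree.PureStrategy) : bitsTree.vector σ = bitsVector fun a => (σ a).1 := by
    ext ⟨a, b⟩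
    refine (Finset.sum_apply _ _ _).trans ?_
    change ∑ a', (Pi.single (a', (σ a').1) (1 : ℝ) : Bool × Bool → ℝ) (a, b) = _
    rw [Fintype.sum_bool]
    cases a <;> simp [Pi.single_apply, bitsVector]
  constructor
  · rintro ⟨σ, rfl⟩
    exact ⟨_, aux σ⟩
  · rintro ⟨h, rfl⟩
    exact ⟨fun a => (h a, fun _ => ()), aux _⟩

/-- The strategy that plays `h a` at the decision point `a`. -/
def bitsPure (h : Bool → Bool) : bits.Pure :=
  ⟨bitsVector h, mem_pureVectors_bitsTree.2 ⟨h, rfl⟩⟩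

/-- The bits that are chosen by a strategy. -/
def chosenBits (y : bits.Pure) : Bool → Bool := (mem_pureVectors_bitsTree.1 y.2).choose

theorem bitsVector_chosenBits (y : bits.Pure) : y.1 = bitsVector (chosenBits y) :=
  (mem_pureVectors_bitsTree.1 y.2).choose_spec

theorem bitsVector_injective : Function.Injective bitsVector := by
  intro h h' he
  ext1 a
  have := congrFun he (a, h a)
  by_contra hne
  simp [bitsVector, hne] at this

theorem chosenBits_bitsPure (h : Bool → Bool) : chosenBits (bitsPure h) = h :=
  (bitsVector_injective (bitsVector_chosenBits (bitsPure h))).symm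

/-- The strategy that plays the parity of the bits `h` everywhere. -/
def parityPure (h : Bool → Bool) : bits.Pure := bitsPure fun _ => xor (h false) (h true)

/-- The deviation that plays the parity of both recommended bits. -/
def parityDeviation (y : bits.Pure) : bits.Mixed := bits.incl (parityPure (chosenBits y))

theorem parityDeviation_mem_mediatorDeviations {k : ℕ} (hk : 2 ≤ k) :
    parityDeviation ∈ mediatorDeviations k bits bits := by
  let i₀ : Fin k := ⟨0, by omega⟩
  let i₁ : Fin k := ⟨1, by omega⟩
  -- Mediator `i₁` asks for the bit at `true`; `i₀` and all surplus mediators ask for the bit at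
  -- `false`.
  let bit : Fin k → Bool := fun l => decide (l = i₁)
  have h₀ : bit i₀ = false := by simp [bit, i₀, i₁]
  have h₁ : bit i₁ = true := by simp [bit]
  have key : Achieves bitsVector bitsTree (fun _ : Fin k => bitsTree.dual)
      (∑ a : Bool, ∑ s : Fin k → Bool, fun h =>
        Pi.single (a, xor (s i₀) (s i₁)) (∏ l, bitsVector h (bit l, s l))) := by
    refine Achieves.observation (fun l => trivial) fun a => ?_
    refine Achieves.gather (t := decision fun b : Bool => terminal (a, b))
      (O := fun l => observation fun b : Bool => terminal (bit l, b))
      (E := fun l b => terminal (bit l, b)) trivial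
      (fun l => Move.mk (fun a => observation fun b : Bool => terminal (a, b)) (bit l))
      (fun l => Observe.mk _) (fun _ _ => trivial) fun s => ?_
    exact Achieves.decision (xor (s i₀) (s i₁)) (fun _ => trivial)
      (achieves_terminal bitsVector (a, xor (s i₀) (s i₁)) fun l => (bit l, s l))
  obtain ⟨q, hq, h⟩ := key
  refine ⟨q, subset_convexHull ℝ _ hq, fun y (z : Bool × Bool) => ?_⟩
  have := h (chosenBits y) z
  rw [← bitsVector_chosenBits] at this
  refine Eq.trans ?_ this.symm
  change bitsVector (fun _ => xor (chosenBits y false) (chosenBits y true)) z = _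
  generalize chosenBits y = c
  have hs : ∀ a : Bool, (∑ s : Fin k → Bool, fun h : Bool → Bool =>
      (Pi.single (a, xor (s i₀) (s i₁)) (∏ l, bitsVector h (bit l, s l)) : Bool × Bool → ℝ)) c =
      Pi.single (a, xor (c false) (c true)) 1 := by
    intro a
    rw [Finset.sum_apply, Finset.sum_eq_single fun l => c (bit l)]
    · simp [h₀, h₁, bitsVector]
    · intro s _ hs
      obtain ⟨l, hl⟩ := Function.ne_iff.1 hs
      rw [Finset.prod_eq_zero (Finset.mem_univ l) (by simp [bitsVector, hl]), Pi.single_zero]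
    · simp
  rw [Finset.sum_apply, Finset.sum_congr rfl fun a _ => hs a, Finset.sum_apply, Fintype.sum_bool]
  obtain ⟨a, b⟩ := z
  cases a <;> simp [Pi.single_apply, bitsVector]

/-- The sign of the action at the first decision point. -/
def bitSign : (Bool × Bool → ℝ) →ₗ[ℝ] ℝ :=
  LinearMap.proj (R := ℝ) (φ := fun _ : Bool × Bool => ℝ) (false, true) -
    LinearMap.proj (R := ℝ) (φ := fun _ : Bool × Bool => ℝ) (false, false)

theorem bitSign_bitsVector (h : Bool → Bool) :
    bitSign (bitsVector h) = if h false then 1 else -1 := by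
  cases hf : h false <;> simp [bitSign, bitsVector, hf]

/-- The first player wants to match the action of the second player, who is indifferent. -/
def matchingGame : Game 2 where
  X := fun _ => bits
  u := fun i => if i = 0 then
    (MultilinearMap.mkPiAlgebra ℝ (Fin 2) ℝ).compLinearMap fun _ => bitSign else 0
  abs_u_le_one := fun i x => by
    have hx : ∀ y : bits.Pure, |bitSign y.1| = 1 := fun y => by
      rw [bitsVector_chosenBits y, bitSign_bitsVector]
      split_ifs <;> simp
    split_ifs
    · refine (congrArg abs (Fin.prod_univ_two fun j => bitSign (x j).1)).le.trans ?_
      rw [abs_mul]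
      exact (congrArg₂ (· * ·) (hx (x 0)) (hx (x 1))).le.trans (by norm_num)
    · simp

theorem matchingGame_utility_zero (x : Fin 2 → bits.Mixed) :
    matchingGame.utility 0 x = bitSign (x 0).1 * bitSign (x 1).1 :=
  Fin.prod_univ_two fun j => bitSign (x j).1

theorem matchingGame_utility_update (x : Fin 2 → bits.Mixed) (m : bits.Mixed) :
    matchingGame.utility 0 (Function.update x 0 m) = bitSign m.1 * bitSign (x 1).1 := by
  refine (matchingGame_utility_zero (Function.update (β := fun _ => bits.Mixed) x 0 m)).trans ?_
  rw [Function.update_self, Function.update_of_ne one_ne_zero]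

theorem matchingGame_utility_one (x : Fin 2 → bits.Mixed) : matchingGame.utility 1 x = 0 :=
  rfl

/-- A pair of bits as a function. -/
def pairBits (p : Bool × Bool) (a : Bool) : Bool := if a then p.2 else p.1

/-- Two uniformly random bits are recommended to the first player, their parity is recommended to
the second player. -/
def parityProfile : matchingGame.CorrelatedProfile :=
  (PMF.uniformOfFintype (Bool × Bool)).map fun p i =>
    if i = 0 then bitsPure (pairBits p) else parityPure (pairBits p)

theorem expect_parityProfile (f : bits.Pure → bits.Pure → ℝ) :
    expect parityProfile (fun x => f (x 0) (x 1)) =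
      4⁻¹ * ∑ p : Bool × Bool, f (bitsPure (pairBits p)) (parityPure (pairBits p)) := by
  rw [parityProfile, expect_map, expect, Finset.mul_sum]
  refine Finset.sum_congr rfl fun p _ => ?_
  rw [PMF.uniformOfFintype_apply]
  simp only [smul_eq_mul]
  congr 1
  simp

theorem expect_parityProfile_linear (T : (Bool × Bool → ℝ) →ₗ[ℝ] ℝ) :
    expect parityProfile (fun x => T (x 0).1 * bitSign (x 1).1) = 0 := by
  refine (expect_parityProfile fun y y' => T y.1 * bitSign y'.1).trans ?_
  -- The two even pairs and the two odd pairs have the same vector sum, so no linear function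
  -- correlates with the parity.
  have e : T (bitsVector (pairBits (false, false))) + T (bitsVector (pairBits (true, true))) =
      T (bitsVector (pairBits (false, true))) + T (bitsVector (pairBits (true, false))) := by
    rw [← map_add, ← map_add]
    congr 1
    ext ⟨_ | _, _ | _⟩ <;> simp [bitsVector, pairBits]
  have hs : ∀ h, bitSign (parityPure h).1 = if xor (h false) (h true) then 1 else -1 :=
    fun h => bitSign_bitsVector fun _ => xor (h false) (h true)
  simp only [Fintype.sum_prod_type, Fintype.sum_bool, hs]
  simp only [bitsPure, pairBits] at e ⊢
  simp
  linarith

theorem parityProfile_isEquilibrium :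
    matchingGame.IsEquilibrium linearDeviations 0 parityProfile := by
  intro i ψ hψ
  obtain ⟨T, hT⟩ := hψ
  have hi : i = 0 ∨ i = 1 := by omega
  rcases hi with rfl | rfl
  · have h1 := expect_parityProfile_linear (bitSign ∘ₗ T)
    have h2 := expect_parityProfile_linear bitSign
    refine le_of_eq ?_
    rw [add_zero]
    refine Eq.trans ?_ (h1.trans (h2.symm.trans ?_))
    · refine congrArg _ (funext fun x => 
        (matchingGame_utility_update (fun j => bits.incl (x j)) (ψ (x 0))).trans ?_)
      exact congrArg (bitSign · * _) (hT (x 0))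
    · exact congrArg _ (funext fun x => (matchingGame_utility_zero fun j => bits.incl (x j)).symm)
  · refine le_of_eq ?_
    rw [add_zero]
    exact congrArg _ (funext fun x =>
      (matchingGame_utility_one _).trans (matchingGame_utility_one _).symm)

theorem not_isEquilibrium_parityProfile {k : ℕ} (hk : 2 ≤ k) :
    ¬ matchingGame.IsEquilibrium (mediatorDeviations k) 0 parityProfile := by
  intro h
  have h := h 0 parityDeviation (parityDeviation_mem_mediatorDeviations hk)
  have h2 : expect parityProfile (fun x => matchingGame.utility 0
      fun j => (matchingGame.X j).incl (x j)) = 0 :=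
    (congrArg _ (funext fun x => matchingGame_utility_zero _)).trans
      (expect_parityProfile_linear bitSign)
  have h1 : expect parityProfile (fun x => matchingGame.utility 0
      (Function.update (fun j => (matchingGame.X j).incl (x j)) 0 (parityDeviation (x 0)))) = 1 := by
    refine (congrArg _ (funext fun x => ?_)).trans ((expect_parityProfile fun y y' =>
      bitSign (parityPure (chosenBits y)).1 * bitSign y'.1).trans ?_)
    · exact matchingGame_utility_update (fun j => bits.incl (x j)) (parityDeviation (x 0))
    · have hs : ∀ h, bitSign (parityPure h).1 * bitSign (parityPure h).1 = 1 := fun h => by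
        rw [parityPure, bitsPure, bitSign_bitsVector]
        split_ifs <;> norm_num
      simp only [chosenBits_bitsPure, hs]
      simp
  rw [h1, h2] at h
  norm_num at h

end Parity

end TreeForm

end

theorem mainTheorem10 :
    (∀ (k : ℕ), 1 ≤ k → ∀ (n : ℕ) (G : TreeForm.Game n) (ε : ℝ), 0 ≤ ε →
      ∀ π : G.CorrelatedProfile, G.IsEquilibrium TreeForm.linearDeviations ε π →
        ∃ P : G.GeneralizedProfile,
          P.IsEquilibrium (TreeForm.mediatorDeviations k) ε ∧
          P.Equivalent (TreeForm.Game.GeneralizedProfile.canonical π)) ∧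
    (∀ (k : ℕ), 2 ≤ k → ∀ δ : TreeForm.StrategyMap, δ.Consistent →
      ¬ TreeForm.SatisfiesRevelationPrinciple δ (TreeForm.mediatorDeviations k) 0) := by
  refine ⟨fun k hk n G ε _ π hπ => ?_, fun k hk δ hδ h => ?_⟩
  · have : NeZero k := ⟨by omega⟩
    exact ⟨G.sharedProfile k π, TreeForm.Game.sharedProfile_isEquilibrium π hπ,
      TreeForm.Game.sharedProfile_equivalent π⟩
  · have : NeZero k := ⟨by omega⟩
    have h := h 2 _ _ (TreeForm.Game.sharedProfile_isEquilibrium (k := k) _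
      TreeForm.parityProfile_isEquilibrium)
    -- The induced canonical profile is the parity profile itself, whatever `δ` does at points that
    -- are not pure.
    rw [TreeForm.Game.GeneralizedProfile.induced_of_equivalent_canonical hδ
      (TreeForm.Game.sharedProfile_equivalent _)] at h
    exact TreeForm.not_isEquilibrium_parityProfile hk h
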